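/- Let $\bar{\mathbb R}=\mathbb R\cup\{+\infty\}$ and let $\Theta$ be a probability measure on $\bar{\mathbb R}^{\mathbb N^*}$ (an offspring law; $x_i=+\infty$ means that the $i$-th child does not exist, and $e^{-\infty}=0$, $\infty\cdot e^{-\infty}=\infty^2 e^{-\infty}=0$). Assume the boundary case with finite variance: $$\int \sum_{i} e^{-x_i}\,d\Theta=1,\qquad \int \sum_i x_ie^{-x_i}\,d\Theta=0,\qquad \sigma^2=\int \sum_i x_i^2e^{-x_i}\,d\Theta\in(0,\infty).$$ For $x\in\mathbb R$ let $\mathbb P^*_x$ be the law of the spinal branching random walk $((X_u)_{u\in\mathcal U},(\xi_n)_{n\ge0})$ started at $x$, where $\mathcal U=\bigcup_{n\ge0}(\mathbb N^*)^n$: the root $\xi_0=\varnothing$ has position $X_{\varnothing}=x$; given generation $n$, the particles $u\neq\xi_n$ of generation $n$ have children at positions $X_{ui}=X_u+x_i$ with $(x_i)_{i\ge1}$ of law $\Theta$, while for $\xi_n$ the vector $(x_i)_{i\ge1}$ has the size-biased law $\Theta^*$ with $d\Theta^*/d\Theta=\sum_ie^{-x_i}$, all these vectors being independent; and then $\xi_{n+1}=\xi_ni$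 with conditional probability $e^{-x_i}/\sum_je^{-x_j}$, where $(x_j)_j$ is the vector used at $\xi_n$. Non-existing particles have position $+\infty$. Let $\mathcal F_n=\sigma(X_u,\,|u|\le n;\ \xi_k,\,k\le n)$ and $\mathcal F_\infty=\bigvee_n\mathcal F_n$, and let $$R(y)=\sum_{n\ge0}\mathbb P^*_0\Big(X_{\xi_n}\ge -y,\ X_{\xi_n}<X_{\xi_k}\ \text{for all } 0\le k<n\Big)$$ be the renewal function of the strictly descending ladder heights of $(X_{\xi_n})_{n\ge0}$. Let $x\ge0$. There is exactly one probability measure $\mathbb P^+_x$ on $\mathcal F_\infty$ such that for every $n\ge0$ $$\frac{d\mathbb P^+_x}{d\mathbb P^*_x}\Big|_{\mathcal F_n}=\frac{R(X_{\xi_n})}{R(x)}\,\mathbf 1_{\{\min_{k\le n}X_{\xi_k}\ge0\}} .$$ Let $(Y_n)_{n\ge0}$ be a sequence of real random variables, adapted to $(\mathcal F_n)_{n\ge0}$ and uniformly bounded (for some constant $C$, $|Y_n|\le C$ holds $\mathbb P^*_x$-almost surely for every $n$), and let $Y_\infty$ be a random variable such that $Y_n\to Y_\infty$ in probability under $\mathbb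 P^+_x$. Then $$\lim_{n\to\infty}\mathbb E^*_x\Big[Y_n\,\Big|\,\min_{k\le n}X_{\xi_k}\ge0\Big]=\mathbb E^+_x[Y_\infty].$$ -/

import Mathlib

open MeasureTheory ProbabilityTheory Filter Topology
open scoped ENNReal

noncomputable section

namespace SpinalBRW

/-- Vertices of the Ulam–Harris tree, as finite words. A word is stored with its last letter first:
the root is `[]` and the `i`-th child of `u` is `i :: u`. The generation of `u` is `u.length`.
The alphabet is indexed by `ℕ` instead of `{1, 2, …}`. -/
abbrev Vertex : Type := List ℕ

instance : MeasurableSpace Vertex := ⊤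

instance : DiscreteMeasurableSpace Vertex := ⟨fun _ => trivial⟩

/-- Vectors of displacements of the children of a particle; `⊤ = +∞` at index `i` means that the
`i`-th child does not exist. -/
abbrev Offspring : Type := ℕ → WithTop ℝ

/-- `e^{-y}`, with `e^{-∞} = 0`. -/
def expNeg (y : WithTop ℝ) : ℝ := if y = ⊤ then 0 else Real.exp (-(y.untopD 0))

/-- `∑_i e^{-x_i}`, the sum being over the existing children. -/
def weight (v : Offspring) : ℝ≥0∞ := ∑' i, ENNReal.ofReal (expNeg (v i))

/-- The standing assumptions on the offspring law `Θ`: boundary case, and `σ² ∈ (0, ∞)`.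
Terms with `v i = ⊤` vanish because of the factor `expNeg (v i)`. -/
structure BoundaryCase (Θ : Measure Offspring) : Prop where
  normalized : ∫⁻ v, weight v ∂Θ = 1
  centered : ∫ v, ∑' i, (v i).untopD 0 * expNeg (v i) ∂Θ = 0
  variance_pos : 0 < ∫⁻ v, ∑' i, ENNReal.ofReal ((v i).untopD 0 ^ 2 * expNeg (v i)) ∂Θ
  variance_lt_top : ∫⁻ v, ∑' i, ENNReal.ofReal ((v i).untopD 0 ^ 2 * expNeg (v i)) ∂Θ < ∞

/-- The size-biased reproduction law `Θ*`. -/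
def sizeBiased (Θ : Measure Offspring) : Measure Offspring := Θ.withDensity weight

/-- Reproduction of a spine particle together with the choice of the next spine particle: the
displacement vector `v` has law `Θ*`, and given `v` the index `i` is chosen with probability
`e^{-v_i} / ∑_j e^{-v_j}`. -/
def spineStep (Θ : Measure Offspring) : Measure (Offspring × ℕ) :=
  ((sizeBiased Θ).prod Measure.count).withDensity
    (fun p => ENNReal.ofReal (expNeg (p.1 p.2)) / weight p.1)

/-- Independent inputs of the spinal branching random walk: a displacement vector for each vertex
(used if the vertex is off the spine), and for each generation the displacement vector of the spine
particle together with the index of its child on the spine. -/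
abbrev Input : Type := (Vertex → Offspring) × (ℕ → Offspring × ℕ)

/-- Off-spine vectors are i.i.d. with law `Θ`, spine steps are i.i.d. with law `spineStep Θ`. -/
def inputLaw (Θ : Measure Offspring) : Measure Input :=
  (Measure.infinitePi fun _ : Vertex => Θ).prod (Measure.infinitePi fun _ : ℕ => spineStep Θ)

/-- The spine `ξ_n`. -/
def spineOf (a : Input) : ℕ → Vertex
  | 0 => []
  | n + 1 => (a.2 n).2 :: spineOf a n

/-- The positions `X_u` of the particles when the root sits at `x`. -/
def positionOf (x : ℝ) (a : Input) : Vertex → WithTop ℝ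
  | [] => (x : WithTop ℝ)
  | i :: u => positionOf x a u +
      (if u = spineOf a u.length then (a.2 u.length).1 i else a.1 u i)

/-- The canonical space of branching random walks with a spine: positions `(X_u)_u` and spine
`(ξ_n)_n`. -/
abbrev Path : Type := (Vertex → WithTop ℝ) × (ℕ → Vertex)

/-- The law `P*_x` of the spinal branching random walk started at `x`. -/
def starLaw (Θ : Measure Offspring) (x : ℝ) : Measure Path :=
  (inputLaw Θ).map fun a => (positionOf x a, spineOf a)

/-- The position `X_{ξ_n}` of the spine at generation `n`. -/
def spinePos (n : ℕ) (ω : Path) : WithTop ℝ := ω.1 (ω.2 n)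

/-- The event `min_{k ≤ n} X_{ξ_k} ≥ 0`. -/
def stayNonneg (n : ℕ) : Set Path := {ω | ∀ k ≤ n, 0 ≤ spinePos k ω}

/-- The filtration `F_n` generated by the positions and the spine up to generation `n`. -/
def canonicalFiltration : Filtration ℕ (inferInstance : MeasurableSpace Path) where
  seq n :=
    (⨆ u : Vertex, ⨆ _ : u.length ≤ n,
      MeasurableSpace.comap (fun ω : Path => ω.1 u) inferInstance) ⊔
    (⨆ k : ℕ, ⨆ _ : k ≤ n, MeasurableSpace.comap (fun ω : Path => ω.2 k) inferInstance)
  mono' _ _ hmn := sup_le_sup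
    (iSup_mono fun _ => iSup_mono' fun h => ⟨h.trans hmn, le_rfl⟩)
    (iSup_mono fun _ => iSup_mono' fun h => ⟨h.trans hmn, le_rfl⟩)
  le' _ := sup_le
    (iSup₂_le fun u _ => ((measurable_pi_apply u).comp measurable_fst).comap_le)
    (iSup₂_le fun k _ => ((measurable_pi_apply k).comp measurable_snd).comap_le)

/-- The renewal function of the strictly descending ladder heights of the spine,
`R(y) = ∑_{n ≥ 0} P*_0(X_{ξ_n} ≥ -y, X_{ξ_n} < X_{ξ_k} for all k < n)`. -/
def renewal (Θ : Measure Offspring) (y : ℝ) : ℝ≥0∞ :=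
  ∑' n : ℕ, starLaw Θ 0
    {ω | ((-y : ℝ) : WithTop ℝ) ≤ spinePos n ω ∧ ∀ k < n, spinePos n ω < spinePos k ω}

/-- `P` is the law `P⁺_x`: a probability measure whose density with respect to `P*_x` on `F_n` is
`R(X_{ξ_n}) 1_{min_{k ≤ n} X_{ξ_k} ≥ 0} / R(x)`, for every `n`. (The spine position is
`P*_x`-almost surely finite, so the value of `R` at `+∞` plays no role.) -/
structure IsPlusLaw (Θ : Measure Offspring) (x : ℝ) (P : Measure Path) : Prop where
  isProbabilityMeasure : IsProbabilityMeasure P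
  density : ∀ (n : ℕ) (A : Set Path), MeasurableSet[canonicalFiltration n] A →
    P A = ∫⁻ ω in A, (stayNonneg n).indicator
      (fun ω => renewal Θ ((spinePos n ω).untopD 0) / renewal Θ x) ω ∂(starLaw Θ x)

/-! The following facts check that the measures above are probability measures and that the
law `starLaw` is not the junk value of `Measure.map` at a non-measurable function. -/

lemma measurable_expNeg : Measurable expNeg :=
  Measurable.ite (measurableSet_singleton _) measurable_const
    (Real.measurable_exp.comp (WithTop.measurable_untopD 0).neg)

lemma measurable_weight : Measurable weight :=
  Measurable.tsum fun i =>
    (measurable_expNeg.comp (measurable_pi_apply i)).ennreal_ofReal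

lemma isProbabilityMeasure_spineStep (Θ : Measure Offspring) [IsProbabilityMeasure Θ]
    (h : BoundaryCase Θ) : IsProbabilityMeasure (spineStep Θ) := by
  have hw := measurable_weight
  have he : Measurable fun p : Offspring × ℕ => expNeg (p.1 p.2) :=
    measurable_from_prod_countable_left fun i =>
      measurable_expNeg.comp (measurable_pi_apply i)
  have : IsProbabilityMeasure (sizeBiased Θ) := ⟨by
    rw [sizeBiased, withDensity_apply _ MeasurableSet.univ, Measure.restrict_univ, h.normalized]⟩
  have hq : Measurable fun p : Offspring × ℕ =>
      ENNReal.ofReal (expNeg (p.1 p.2)) / weight p.1 :=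
    he.ennreal_ofReal.div (hw.comp measurable_fst)
  refine ⟨?_⟩
  rw [spineStep, withDensity_apply _ MeasurableSet.univ, Measure.restrict_univ,
    lintegral_prod _ hq.aemeasurable]
  have h1 : ∀ v : Offspring,
      ∫⁻ i : ℕ, ENNReal.ofReal (expNeg (v i)) / weight v ∂Measure.count = weight v / weight v := by
    intro v
    rw [lintegral_count]
    simp only [div_eq_mul_inv, ENNReal.tsum_mul_right]
    rfl
  simp only [h1]
  have hww : Measurable fun v => weight v / weight v := hw.div hw
  rw [sizeBiased, lintegral_withDensity_eq_lintegral_mul _ hw hww]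
  rw [← h.normalized]
  have hfin : ∀ᵐ v ∂Θ, weight v < ∞ :=
    ae_lt_top hw (by rw [h.normalized]; exact ENNReal.one_ne_top)
  refine lintegral_congr_ae (hfin.mono fun v hv => ?_)
  by_cases h0 : weight v = 0
  · simp [h0]
  · simp [ENNReal.div_self h0 hv.ne]

lemma measurable_withTop_add :
    Measurable fun p : WithTop ℝ × WithTop ℝ => p.1 + p.2 := by
  have : (fun p : WithTop ℝ × WithTop ℝ => p.1 + p.2) = fun p =>
      if p.1 = ⊤ ∨ p.2 = ⊤ then ⊤ else ((p.1.untopD 0 + p.2.untopD 0 : ℝ) : WithTop ℝ) := by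
    funext ⟨a, b⟩
    induction a <;> induction b <;> simp
  rw [this]
  refine Measurable.ite ?_ measurable_const ?_
  · exact (measurable_fst (measurableSet_singleton _)).union
      (measurable_snd (measurableSet_singleton _))
  · exact WithTop.measurable_coe.comp
      (((WithTop.measurable_untopD 0).comp measurable_fst).add
        ((WithTop.measurable_untopD 0).comp measurable_snd))

lemma measurable_spineOf (n : ℕ) : Measurable fun a : Input => spineOf a n := by
  induction n with
  | zero => exact measurable_const
  | succ n ih =>
    have h1 : Measurable fun a : Input => (a.2 n).2 :=
      measurable_snd.comp ((measurable_pi_apply n).comp measurable_snd)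
    exact (Measurable.of_discrete (f := fun p : ℕ × Vertex => p.1 :: p.2)).comp (h1.prodMk ih)

lemma measurable_positionOf (x : ℝ) (u : Vertex) :
    Measurable fun a : Input => positionOf x a u := by
  induction u with
  | nil => exact measurable_const
  | cons i u ih =>
    refine measurable_withTop_add.comp (ih.prodMk (Measurable.ite ?_ ?_ ?_))
    · have : {a : Input | u = spineOf a u.length} =
          (fun a : Input => spineOf a u.length) ⁻¹' {u} := by
        ext a; simp [eq_comm]
      rw [this]
      exact measurable_spineOf _ (measurableSet_singleton _)
    · exact (measurable_pi_apply i).comp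
        (measurable_fst.comp ((measurable_pi_apply u.length).comp measurable_snd))
    · exact (measurable_pi_apply i).comp ((measurable_pi_apply u).comp measurable_fst)

lemma isProbabilityMeasure_starLaw (Θ : Measure Offspring) [IsProbabilityMeasure Θ]
    (h : BoundaryCase Θ) (x : ℝ) : IsProbabilityMeasure (starLaw Θ x) := by
  have := isProbabilityMeasure_spineStep Θ h
  have : IsProbabilityMeasure (inputLaw Θ) := by unfold inputLaw; infer_instance
  exact Measure.isProbabilityMeasure_map
    ((measurable_pi_lambda _ (measurable_positionOf x)).prodMk
      (measurable_pi_lambda _ measurable_spineOf)).aemeasurable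

end SpinalBRW

end

/-!
Under `P*_x` the spine is a random walk whose steps are centered with finite variance: integrals
against the size-biased law turn into the sums of the boundary case. By the central limit theorem,
its position at time `n` is nonnegative with probability tending to `1/2` (Spitzer's condition).

Splitting the convolution semiring of finite measures into the parts on `[0, ∞)` and `(-∞, 0)`,
the generating series of the walk killed on entering either half-line multiply to `∑ Fⁿ sⁿ`
(Wiener–Hopf). Differentiating this identity gives Spitzer's recursion
`(n + 1) h (n + 1) = ∑ p (k + 1) h (n - k)` for the probability `h n` that the walk started at `0`
stays nonnegative up to time `n`. As `p` converges to a positive limit and `h` is nonincreasing, `h`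
varies slowly over short multiplicative ranges, and decomposing the walk at its minimum shows that
the survival probability started at `x` is equivalent to `R(x) h n`.

The function `R` is harmonic for the killed walk, and `P⁺_x` is its Doob transform. The density on
`F_n` of the law conditioned to stay nonnegative up to time `n + j` is a ratio of survival
probabilities: it converges to the density of `P⁺_x` as `j → ∞`, and is bounded by a multiple of it
as long as `n = O(j)`. This gives the limit when the conditioning goes a fixed proportion `1/q`
beyond time `n`, and by slow variation that prolongation has a negligible effect when `q` is large.
-/

namespace SpinalBRW

/-! ### Wiener–Hopf factorization and Spitzer's identity in a split semiring -/

section Fluctuation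

open Finset PowerSeries

variable {M : Type*} [CommSemiring M]

/-- The powers of `f`, projected by `P` after each multiplication. If `f` is the law of the steps
of a random walk and `P` the restriction to a set, this is the law of the walk killed on leaving
that set. -/
def killedPow (P : M →+ M) (f : M) : ℕ → M
  | 0 => 1
  | n + 1 => P (killedPow P f n * f)

/-- A splitting of a semiring into two complementary parts closed under multiplication, the first
of which contains `1`. The parts are encoded by the projections `P` and `Q` onto them, so that the
first part is the kernel of `Q` and the second one the kernel of `P`. -/
structure IsSplitting (P Q : M →+ M) : Prop where
  add_eq : ∀ u, P u + Q u = u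
  right_left : ∀ u, Q (P u) = 0
  left_right : ∀ u, P (Q u) = 0
  right_mul : ∀ u v, Q u = 0 → Q v = 0 → Q (u * v) = 0
  left_mul : ∀ u v, P u = 0 → P v = 0 → P (u * v) = 0
  right_one : Q 1 = 0

lemma sum_killedPow_mul_killedPow_mul_add {P Q : M →+ M} (add_eq : ∀ u, P u + Q u = u) (f : M)
    (n : ℕ) :
    (∑ p ∈ antidiagonal n, killedPow P f p.1 * killedPow Q f p.2) * f + killedPow P f (n + 1) =
      ∑ p ∈ antidiagonal (n + 1), killedPow P f p.1 * killedPow Q f p.2 +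
        ∑ p ∈ antidiagonal n, killedPow P f p.1 * P (killedPow Q f p.2 * f) := by
  rw [Nat.sum_antidiagonal_succ', sum_mul, add_assoc, ← sum_add_distrib, add_comm]
  congr 1
  · simp only [killedPow, mul_one]
  · refine sum_congr rfl fun p _ => ?_
    rw [← mul_add, mul_assoc, killedPow, add_comm (Q _), add_eq]

namespace IsSplitting

variable {P Q : M →+ M}

lemma right_killedPow (h : IsSplitting P Q) (f : M) (n : ℕ) : Q (killedPow P f n) = 0 := by
  cases n with
  | zero => exact h.right_one
  | succ n => exact h.right_left _

lemma left_killedPow_succ (h : IsSplitting P Q) (f : M) (n : ℕ) :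
    P (killedPow Q f (n + 1)) = 0 :=
  h.left_right _

lemma left_mul_killedPow (h : IsSplitting P Q) (f : M) {u : M} (hu : P u = 0) (n : ℕ) :
    P (u * killedPow Q f n) = 0 := by
  cases n with
  | zero => rwa [killedPow, mul_one]
  | succ n => exact h.left_mul _ _ hu (h.left_killedPow_succ f n)

theorem sum_killedPow_mul_killedPow [IsCancelAdd M] (h : IsSplitting P Q) (f : M) (n : ℕ) :
    ∑ p ∈ antidiagonal n, killedPow P f p.1 * killedPow Q f p.2 = f ^ n := by
  induction n with
  | zero => simp [killedPow]
  | succ n ih =>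
    have hP := sum_killedPow_mul_killedPow_mul_add h.add_eq f n
    have hQ := sum_killedPow_mul_killedPow_mul_add (fun u => (add_comm _ _).trans (h.add_eq u)) f n
    simp only [mul_comm (killedPow Q f _)] at hQ
    rw [← Nat.sum_antidiagonal_swap, ← Nat.sum_antidiagonal_swap (n := n + 1)] at hQ
    simp only [Prod.fst_swap, Prod.snd_swap] at hQ
    rw [ih, ← pow_succ] at hP hQ
    have right_eq := congrArg Q hP
    have left_eq := congrArg P hQ
    rw [map_add, map_add, h.right_killedPow, map_sum Q _ (antidiagonal n),
      sum_eq_zero fun p _ => h.right_mul _ _ (h.right_killedPow f _) (h.right_left _),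
      add_zero, add_zero] at right_eq
    rw [map_add, map_add, h.left_killedPow_succ,
      map_sum P (fun p : ℕ × ℕ => Q (killedPow P f p.2 * f) * killedPow Q f p.1) (antidiagonal n),
      sum_eq_zero fun p _ => h.left_mul_killedPow f (h.left_right _) _,
      add_zero, add_zero] at left_eq
    rw [← h.add_eq (f ^ (n + 1)), right_eq, left_eq, h.add_eq]

lemma eq_and_eq_of_add_eq_add (h : IsSplitting P Q) {u u' v v' : M} (hu : Q u = 0)
    (hu' : Q u' = 0) (hv : P v = 0) (hv' : P v' = 0) (huv : u + v = u' + v') :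
    u = u' ∧ v = v' := by
  have left_eq := congrArg P huv
  have right_eq := congrArg Q huv
  rw [map_add, map_add, hv, hv', add_zero, add_zero] at left_eq
  rw [map_add, map_add, hu, hu', zero_add, zero_add] at right_eq
  constructor
  · rw [← h.add_eq u, ← h.add_eq u', left_eq, hu, hu']
  · rw [← h.add_eq v, ← h.add_eq v', right_eq, hv, hv']

end IsSplitting

lemma coeff_add_coeff_mul_eq {X X' B : M⟦X⟧} (hB : coeff 0 B = 1) (n : ℕ)
    (hX : ∀ k < n, coeff k X = coeff k X') :
    coeff n X + coeff n (X' * B) = coeff n X' + coeff n (X * B) := by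
  cases n with
  | zero => simp only [coeff_mul, Nat.antidiagonal_zero, sum_singleton, hB, mul_one, add_comm]
  | succ n =>
    have sum_eq : ∑ p ∈ antidiagonal n, coeff p.1 X' * coeff (p.2 + 1) B =
        ∑ p ∈ antidiagonal n, coeff p.1 X * coeff (p.2 + 1) B :=
      sum_congr rfl fun p hp => by rw [hX _ (by have := mem_antidiagonal.1 hp; omega)]
    rw [coeff_mul, coeff_mul, Nat.sum_antidiagonal_succ', Nat.sum_antidiagonal_succ', hB, mul_one,
      mul_one, sum_eq]
    ring

lemma derivative_mk_pow (f : M) :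
    derivative M (PowerSeries.mk fun n => f ^ n) =
      PowerSeries.mk (fun n => f ^ (n + 1)) * PowerSeries.mk fun n => f ^ n := by
  ext n
  have term_eq : ∀ p ∈ antidiagonal n, f ^ (p.1 + 1) * f ^ p.2 = f ^ (n + 1) := fun p hp => by
    rw [← pow_add, add_right_comm, mem_antidiagonal.1 hp]
  simp only [coeff_derivative, coeff_mul, coeff_mk]
  rw [sum_congr rfl term_eq, sum_const, Nat.card_antidiagonal, nsmul_eq_mul, Nat.cast_succ,
    mul_comm]

namespace IsSplitting

variable {P Q : M →+ M} [IsCancelAdd M]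

lemma eq_and_eq_of_mul_add_mul_eq (h : IsSplitting P Q) {A B X X' Y Y' : M⟦X⟧}
    (hA : coeff 0 A = 1) (hB : coeff 0 B = 1) (hX : ∀ n, Q (coeff n X) = 0)
    (hX' : ∀ n, Q (coeff n X') = 0) (hY : ∀ n, P (coeff n Y) = 0) (hY' : ∀ n, P (coeff n Y') = 0)
    (heq : X * B + Y * A = X' * B + Y' * A) : X = X' ∧ Y = Y' := by
  have coeff_eq (n : ℕ) : coeff n X = coeff n X' ∧ coeff n Y = coeff n Y' := by
    induction n using Nat.strong_induction_on with
    | _ n ih =>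
      refine h.eq_and_eq_of_add_eq_add (hX n) (hX' n) (hY n) (hY' n) ?_
      have hXB := coeff_add_coeff_mul_eq hB n fun k hk => (ih k hk).1
      have hYA := coeff_add_coeff_mul_eq hA n fun k hk => (ih k hk).2
      have hn := congrArg (coeff n) heq
      rw [map_add, map_add] at hn
      refine add_right_cancel (b := coeff n (X' * B) + coeff n (Y' * A)) ?_
      rw [add_add_add_comm, hXB, hYA, add_add_add_comm, hn]
  exact ⟨PowerSeries.ext fun n => (coeff_eq n).1, PowerSeries.ext fun n => (coeff_eq n).2⟩

/-- Spitzer's identity `A' = U A`: the logarithmic derivative of the Wiener–Hopf factorization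
`A B = ∑ fⁿ sⁿ` is `A' B + B' A = U A B + V B A`, and the splitting separates the two parts. -/
theorem derivative_mk_killedPow (h : IsSplitting P Q) (f : M) :
    derivative M (PowerSeries.mk (killedPow P f)) =
      PowerSeries.mk (fun n => P (f ^ (n + 1))) * PowerSeries.mk (killedPow P f) := by
  set A := PowerSeries.mk (killedPow P f)
  set B := PowerSeries.mk (killedPow Q f)
  set U := PowerSeries.mk fun n => P (f ^ (n + 1))
  set V := PowerSeries.mk fun n => Q (f ^ (n + 1))
  have factorization : A * B = PowerSeries.mk fun n => f ^ n := by
    ext n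
    simp only [A, B, coeff_mul, coeff_mk, h.sum_killedPow_mul_killedPow]
  have add_eq : U + V = PowerSeries.mk fun n => f ^ (n + 1) := by
    ext n
    simp only [U, V, map_add, coeff_mk, h.add_eq]
  have derivative_eq : derivative M A * B + derivative M B * A = U * A * B + V * B * A :=
    calc derivative M A * B + derivative M B * A = derivative M (A * B) := by
          rw [Derivation.leibniz, smul_eq_mul, smul_eq_mul, add_comm, mul_comm A, mul_comm B]
      _ = (U + V) * (A * B) := by rw [factorization, add_eq, derivative_mk_pow]
      _ = U * A * B + V * B * A := by ring
  have map_coeff_derivative {T : M →+ M} {C : M⟦X⟧} {n : ℕ} (hC : T (coeff (n + 1) C) = 0) :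
      T (coeff n (derivative M C)) = 0 := by
    rw [coeff_derivative, ← Nat.cast_succ, mul_comm, ← nsmul_eq_mul, map_nsmul, hC, nsmul_zero]
  refine (h.eq_and_eq_of_mul_add_mul_eq ?_ ?_ (fun n => map_coeff_derivative ?_) (fun n => ?_)
    (fun n => map_coeff_derivative ?_) (fun n => ?_) derivative_eq).1
  · simp only [A, coeff_mk, killedPow]
  · simp only [B, coeff_mk, killedPow]
  · simpa only [A, coeff_mk] using h.right_killedPow f (n + 1)
  · simp only [U, A, coeff_mul, coeff_mk, map_sum]
    exact sum_eq_zero fun p _ => h.right_mul _ _ (h.right_left _) (h.right_killedPow f _)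
  · simpa only [B, coeff_mk] using h.left_killedPow_succ f n
  · simp only [V, B, coeff_mul, coeff_mk, map_sum]
    exact sum_eq_zero fun p _ => h.left_mul_killedPow f (h.left_right _) _

theorem succ_mul_killedPow_succ (h : IsSplitting P Q) (f : M) (n : ℕ) :
    (n + 1 : M) * killedPow P f (n + 1) =
      ∑ p ∈ antidiagonal n, P (f ^ (p.1 + 1)) * killedPow P f p.2 := by
  have := congrArg (coeff n) (h.derivative_mk_killedPow f)
  simpa only [coeff_derivative, coeff_mul, coeff_mk, mul_comm (killedPow P f (n + 1))] using this

end IsSplitting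

end Fluctuation

/-! ### Tauberian estimates for sequences satisfying Spitzer's recursion -/

section Sequences

open Finset

/-- Partial sums `h 0 + ⋯ + h n`. -/
def partialSum (h : ℕ → ℝ) (n : ℕ) : ℝ := ∑ k ∈ range (n + 1), h k

variable {g h p r : ℕ → ℝ} {ρ R : ℝ}

lemma partialSum_succ (h : ℕ → ℝ) (n : ℕ) : partialSum h (n + 1) = partialSum h n + h (n + 1) :=
  sum_range_succ _ _

lemma partialSum_mono (nonneg : ∀ n, 0 ≤ h n) : Monotone (partialSum h) :=
  monotone_nat_of_le_succ fun n => by rw [partialSum_succ]; linarith [nonneg (n + 1)]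

lemma succ_mul_le_partialSum (anti : Antitone h) (n : ℕ) : (n + 1) * h n ≤ partialSum h n := by
  have := card_nsmul_le_sum (range (n + 1)) h (h n) fun k hk =>
    anti (Nat.lt_succ_iff.1 (mem_range.1 hk))
  simpa [partialSum] using this

lemma sub_mul_le_partialSum_sub (anti : Antitone h) {n m : ℕ} (hnm : n ≤ m) :
    (m - n) * h m ≤ partialSum h m - partialSum h n := by
  have := card_nsmul_le_sum (Ico (n + 1) (m + 1)) h (h m) fun k hk =>
    anti (Nat.lt_succ_iff.1 (mem_Ico.1 hk).2)
  rwa [Nat.card_Ico, Nat.add_sub_add_right, nsmul_eq_mul, Nat.cast_sub hnm,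
    sum_Ico_eq_sub h (Nat.succ_le_succ hnm)] at this

lemma partialSum_sub_le_sub_mul (anti : Antitone h) {n m : ℕ} (hnm : n ≤ m) :
    partialSum h m - partialSum h n ≤ (m - n) * h n := by
  have := sum_le_card_nsmul (Ico (n + 1) (m + 1)) h (h n) fun k hk =>
    anti (Nat.le_of_succ_le (mem_Ico.1 hk).1)
  rwa [Nat.card_Ico, Nat.add_sub_add_right, nsmul_eq_mul, Nat.cast_sub hnm,
    sum_Ico_eq_sub h (Nat.succ_le_succ hnm)] at this

lemma partialSum_eq_sum_antidiagonal (h : ℕ → ℝ) (n : ℕ) :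
    partialSum h n = ∑ q ∈ antidiagonal n, h q.2 := by
  rw [partialSum, Nat.sum_antidiagonal_eq_sum_range_succ_mk, ← sum_range_reflect]
  rfl

lemma tendsto_sub_div_partialSum (nonneg : ∀ n, 0 ≤ h n) (anti : Antitone h) (j : ℕ) :
    Tendsto (fun n => h (n - j) / partialSum h n) atTop (𝓝 0) := by
  have sum_nonneg (n : ℕ) : 0 ≤ partialSum h n := sum_nonneg fun k _ => nonneg k
  refine squeeze_zero (fun n => div_nonneg (nonneg _) (sum_nonneg n)) (fun n => ?_)
    ((tendsto_one_div_add_atTop_nhds_zero_nat (𝕜 := ℝ)).comp (tendsto_sub_atTop_nat j))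
  have le_sum : ((n - j : ℕ) + 1) * h (n - j) ≤ partialSum h n :=
    (succ_mul_le_partialSum anti _).trans (partialSum_mono nonneg (Nat.sub_le n j))
  refine div_le_of_le_mul₀ (sum_nonneg n) Nat.one_div_pos_of_nat.le ?_
  rwa [Function.comp_apply, one_div, inv_mul_eq_div, le_div_iff₀' (by positivity)]

lemma tendsto_sum_mul_div_partialSum (nonneg : ∀ n, 0 ≤ h n) (anti : Antitone h)
    (pos : ∀ n, 0 < partialSum h n) (hp : Tendsto p atTop (𝓝 ρ)) :
    Tendsto (fun n => (∑ q ∈ antidiagonal n, p q.1 * h q.2) / partialSum h n) atTop (𝓝 ρ) := by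
  rw [Metric.tendsto_atTop] at hp
  refine Metric.tendsto_nhds.2 fun ε hε => ?_
  obtain ⟨K, hK⟩ := hp (ε / 2) (half_pos hε)
  have tendsto_head : Tendsto (fun n => ∑ j ∈ range K, |p j - ρ| * (h (n - j) / partialSum h n))
      atTop (𝓝 0) := by
    simpa using tendsto_finsetSum (range K) fun j _ =>
      (tendsto_sub_div_partialSum nonneg anti j).const_mul |p j - ρ|
  filter_upwards [tendsto_head.eventually_lt_const (half_pos hε)] with n hn
  have term_le : ∀ j ∈ range (n + 1), |(p j - ρ) * h (n - j)| ≤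
      ε / 2 * h (n - j) + if j < K then |p j - ρ| * h (n - j) else 0 := fun j _ => by
    rw [abs_mul, abs_of_nonneg (nonneg _)]
    split_ifs with hj
    · exact le_add_of_nonneg_left (mul_nonneg (half_pos hε).le (nonneg _))
    · rw [add_zero]
      exact mul_le_mul_of_nonneg_right (hK j (not_lt.1 hj)).le (nonneg _)
  have head_le : (∑ j ∈ range (n + 1), if j < K then |p j - ρ| * h (n - j) else 0) ≤
      ∑ j ∈ range K, |p j - ρ| * h (n - j) := by
    rw [← sum_filter]
    exact sum_le_sum_of_subset_of_nonneg (fun j hj => mem_range.2 (mem_filter.1 hj).2)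
      fun j _ _ => mul_nonneg (abs_nonneg _) (nonneg _)
  have abs_le : |∑ j ∈ range (n + 1), (p j - ρ) * h (n - j)| ≤
      ε / 2 * partialSum h n + ∑ j ∈ range K, |p j - ρ| * h (n - j) := by
    refine (abs_sum_le_sum_abs _ _).trans ((sum_le_sum term_le).trans ?_)
    rw [sum_add_distrib, ← mul_sum, partialSum_eq_sum_antidiagonal,
      Nat.sum_antidiagonal_eq_sum_range_succ_mk]
    exact add_le_add_right head_le _
  simp only [← mul_div_assoc, ← sum_div] at hn
  rw [div_lt_iff₀ (pos n)] at hn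
  rw [Real.dist_eq, div_sub' (pos n).ne', abs_div, abs_of_pos (pos n), div_lt_iff₀ (pos n),
    mul_comm, partialSum_eq_sum_antidiagonal, mul_sum, ← sum_sub_distrib,
    ← partialSum_eq_sum_antidiagonal, Nat.sum_antidiagonal_eq_sum_range_succ_mk]
  simp only [← sub_mul]
  linarith

lemma partialSum_conv (hg : ∀ n, g n = ∑ q ∈ antidiagonal n, r q.1 * h q.2) (n : ℕ) :
    partialSum g n = ∑ q ∈ antidiagonal n, partialSum r q.1 * h q.2 := by
  have conv_eq (r : ℕ → ℝ) (m : ℕ) : ∑ q ∈ antidiagonal m, r q.1 * h q.2 =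
      ∑ k ∈ range (m + 1), r (m - k) * h k := by
    rw [← Nat.sum_antidiagonal_swap, Nat.sum_antidiagonal_eq_sum_range_succ_mk]
    rfl
  rw [conv_eq (partialSum r)]
  simp only [partialSum, hg, conv_eq, sum_mul]
  rw [sum_range_diag_flip (n + 1) fun k l => r l * h k]
  exact sum_congr rfl fun k hk => by rw [Nat.sub_add_comm (Nat.lt_succ_iff.1 (mem_range.1 hk))]

/-- Differential form of `∑ h n s ^ n = exp (∑ p k s ^ k / k)`, with `p` converging to a positive
limit and `h` nonincreasing. -/
structure SpitzerSeq (h p : ℕ → ℝ) (ρ : ℝ) : Prop where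
  zero : h 0 = 1
  anti : Antitone h
  nonneg : ∀ n, 0 ≤ h n
  succ_mul_eq : ∀ n : ℕ, (n + 1) * h (n + 1) = ∑ q ∈ antidiagonal n, p (q.1 + 1) * h q.2
  tendsto : Tendsto p atTop (𝓝 ρ)
  pos : 0 < ρ

namespace SpitzerSeq

lemma one_le_partialSum (hs : SpitzerSeq h p ρ) (n : ℕ) : 1 ≤ partialSum h n := by
  simpa [partialSum, hs.zero] using partialSum_mono hs.nonneg (Nat.zero_le n)

lemma partialSum_pos (hs : SpitzerSeq h p ρ) (n : ℕ) : 0 < partialSum h n :=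
  zero_lt_one.trans_le (hs.one_le_partialSum n)

lemma tendsto_succ_mul_div_partialSum (hs : SpitzerSeq h p ρ) :
    Tendsto (fun n : ℕ => (n + 1) * h (n + 1) / partialSum h n) atTop (𝓝 ρ) := by
  simp only [hs.succ_mul_eq]
  exact tendsto_sum_mul_div_partialSum (p := fun k => p (k + 1)) hs.nonneg hs.anti
    hs.partialSum_pos ((tendsto_add_atTop_iff_nat 1).2 hs.tendsto)

lemma apply_pos (hs : SpitzerSeq h p ρ) (n : ℕ) : 0 < h n := by
  obtain ⟨m, ratio_pos, hnm⟩ := ((hs.tendsto_succ_mul_div_partialSum.eventually_const_lt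
    hs.pos).and (eventually_ge_atTop n)).exists
  rw [lt_div_iff₀ (hs.partialSum_pos m), zero_mul] at ratio_pos
  exact ((mul_pos_iff_of_pos_left m.cast_add_one_pos).1 ratio_pos).trans_le
    (hs.anti (hnm.trans m.le_succ))

lemma exists_partialSum_le (hs : SpitzerSeq h p ρ) :
    ∃ C : ℝ, 1 ≤ C ∧ ∀ n : ℕ, partialSum h n ≤ C * ((n + 1) * h n) := by
  obtain ⟨C, hC⟩ := (hs.tendsto_succ_mul_div_partialSum.inv₀ hs.pos.ne').bddAbove_range
  refine ⟨max 1 C, le_max_left _ _, fun n => ?_⟩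
  have inv_le : ((n + 1) * h (n + 1) / partialSum h n)⁻¹ ≤ max 1 C :=
    (hC ⟨n, rfl⟩).trans (le_max_right 1 C)
  rw [inv_div, div_le_iff₀ (mul_pos n.cast_add_one_pos (hs.apply_pos _))] at inv_le
  exact inv_le.trans (by gcongr; exact hs.anti n.le_succ)

lemma tendsto_partialSum (hs : SpitzerSeq h p ρ) : Tendsto (partialSum h) atTop atTop := by
  obtain ⟨C, hC1, hC⟩ := hs.exists_partialSum_le
  have hC0 : 0 < C := by linarith
  refine tendsto_atTop_mono (fun n => ?_) ((Real.tendsto_sum_range_one_div_nat_succ_atTop.comp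
    (tendsto_add_atTop_nat 1)).const_mul_atTop (inv_pos.2 hC0))
  rw [Function.comp_apply, mul_sum, partialSum]
  refine sum_le_sum fun k _ => ?_
  rw [inv_mul_le_iff₀ hC0, div_le_iff₀ k.cast_add_one_pos]
  linarith [(hs.one_le_partialSum k).trans (hC k)]

lemma exists_le_mul (hs : SpitzerSeq h p ρ) {c : ℝ} (hc : 1 < c) :
    ∃ η > 0, ∃ N : ℕ, ∀ n m : ℕ, N ≤ n → n ≤ m → (m : ℝ) ≤ (1 + η) * n → h n ≤ c * h m := by
  obtain ⟨κ, hκc, hκ⟩ : ∃ κ : ℝ, κ ^ 3 < c ∧ 1 < κ :=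
    (((continuous_pow 3).tendsto' 1 1 (one_pow 3)).mono_left nhdsWithin_le_nhds
      |>.eventually_lt_const hc |>.and (self_mem_nhdsWithin (s := Set.Ioi 1))).exists
  have hκ0 : 0 < κ := zero_lt_one.trans hκ
  obtain ⟨N, hN⟩ := eventually_atTop.1 <|
    (hs.tendsto_succ_mul_div_partialSum.eventually_const_lt (div_lt_self hs.pos hκ)).and
      (hs.tendsto_succ_mul_div_partialSum.eventually_lt_const (lt_mul_of_one_lt_right hs.pos hκ))
  refine ⟨κ - 1, sub_pos.2 hκ, N + 1, fun n m hNn hnm hm => ?_⟩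
  obtain ⟨n, rfl⟩ : ∃ n', n = n' + 1 := ⟨n - 1, by omega⟩
  obtain ⟨m, rfl⟩ : ∃ m', m = m' + 1 := ⟨m - 1, by omega⟩
  have lower := (hN m (by omega)).1.le
  have upper := (hN n (by omega)).2.le
  rw [le_div_iff₀ (hs.partialSum_pos m), div_mul_eq_mul_div, div_le_iff₀ hκ0] at lower
  rw [div_le_iff₀ (hs.partialSum_pos n)] at upper
  push_cast at hm
  have hhm := hs.nonneg (m + 1)
  have key : (n + 1) * h (n + 1) ≤ (n + 1) * (κ ^ 3 * h (m + 1)) :=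
    calc (n + 1) * h (n + 1) ≤ κ * (ρ * partialSum h n) := by linarith
      _ ≤ κ * (ρ * partialSum h m) := by
        have := hs.pos
        gcongr
        exact partialSum_mono hs.nonneg (by omega)
      _ ≤ κ * ((m + 1) * h (m + 1) * κ) := by gcongr
      _ ≤ κ * ((1 + (κ - 1)) * (n + 1) * h (m + 1) * κ) := by gcongr
      _ = (n + 1) * (κ ^ 3 * h (m + 1)) := by ring
  exact (le_of_mul_le_mul_left key (by positivity)).trans (by gcongr)

lemma tendsto_add_div (hs : SpitzerSeq h p ρ) (k : ℕ) :
    Tendsto (fun n => h (k + n) / h n) atTop (𝓝 1) := by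
  refine tendsto_order.2 ⟨fun a ha => ?_, fun a ha => Eventually.of_forall fun n => ?_⟩
  · rcases le_or_gt a 0 with ha0 | ha0
    · exact Eventually.of_forall fun n => ha0.trans_lt (div_pos (hs.apply_pos _) (hs.apply_pos _))
    obtain ⟨c, hc, hca⟩ := exists_between ((one_lt_inv₀ ha0).2 ha)
    obtain ⟨η, hη, N, hN⟩ := hs.exists_le_mul hc
    filter_upwards [eventually_ge_atTop N,
      tendsto_natCast_atTop_atTop.eventually_ge_atTop ((k : ℝ) / η)] with n hn hkn
    rw [div_le_iff₀ hη] at hkn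
    have le_mul := hN n (k + n) hn (Nat.le_add_left n k) (by push_cast; linarith)
    have := hs.apply_pos (k + n)
    rw [lt_div_iff₀ (hs.apply_pos n)]
    calc a * h n ≤ a * (c * h (k + n)) := by gcongr
      _ < a * (a⁻¹ * h (k + n)) := by gcongr
      _ = h (k + n) := by field_simp
  · exact (div_le_one_of_le₀ (hs.anti (Nat.le_add_left n k)) (hs.nonneg n)).trans_lt ha

lemma apply_le_mul_apply_add (hs : SpitzerSeq h p ρ) {C : ℝ}
    (hC : ∀ n : ℕ, partialSum h n ≤ C * ((n + 1) * h n)) {q n m : ℕ} (hnm : n ≤ q * (m + 1)) :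
    h m ≤ C * (q + 1) * h (n + m) := by
  have hC0 : 0 ≤ C := by
    have := (hs.one_le_partialSum 0).trans (hC 0)
    rw [hs.zero] at this
    push_cast at this
    linarith
  have hnm' : ((n + m : ℕ) + 1 : ℝ) ≤ (q + 1) * (m + 1) := by
    have : (n : ℝ) ≤ q * (m + 1) := by exact_mod_cast hnm
    push_cast
    linarith
  refine le_of_mul_le_mul_left (a := (m + 1 : ℝ)) ?_ (by positivity)
  calc (m + 1) * h m ≤ partialSum h (n + m) :=
        (succ_mul_le_partialSum hs.anti m).trans (partialSum_mono hs.nonneg (Nat.le_add_left m n))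
    _ ≤ C * (((n + m : ℕ) + 1) * h (n + m)) := hC (n + m)
    _ ≤ C * ((q + 1) * (m + 1) * h (n + m)) := by
        have := hs.nonneg (n + m)
        gcongr
    _ = (m + 1) * (C * (q + 1) * h (n + m)) := by ring

lemma exists_eventually_le_mul_add_div (hs : SpitzerSeq h p ρ)
    (hgh : Tendsto (fun n => g n / h n) atTop (𝓝 R)) (hR : 0 < R) {c : ℝ} (hc : 1 < c) :
    ∃ q : ℕ, 0 < q ∧ ∀ᶠ n in atTop, g n ≤ c * g (n + n / q) := by
  obtain ⟨κ, hκc, hκ⟩ : ∃ κ : ℝ, κ ^ 3 < c ∧ 1 < κ :=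
    (((continuous_pow 3).tendsto' 1 1 (one_pow 3)).mono_left nhdsWithin_le_nhds
      |>.eventually_lt_const hc |>.and (self_mem_nhdsWithin (s := Set.Ioi 1))).exists
  have hκ0 : 0 < κ := zero_lt_one.trans hκ
  obtain ⟨η, hη, N, hN⟩ := hs.exists_le_mul hκ
  obtain ⟨q, hq⟩ := exists_nat_one_div_lt hη
  obtain ⟨N', hN'⟩ := eventually_atTop.1 <| (hgh.eventually_const_lt (div_lt_self hR hκ)).and
    (hgh.eventually_lt_const (lt_mul_of_one_lt_right hR hκ))
  refine ⟨q + 1, q.succ_pos, ?_⟩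
  filter_upwards [eventually_ge_atTop N, eventually_ge_atTop N'] with n hNn hNn'
  set m := n + n / (q + 1) with hm
  have hnm : n ≤ m := Nat.le_add_right _ _
  have hmn : (m : ℝ) ≤ (1 + η) * n :=
    calc (m : ℝ) ≤ n + n / (q + 1 : ℕ) := by rw [hm, Nat.cast_add]; gcongr; exact Nat.cast_div_le
      _ = (1 + 1 / (q + 1)) * n := by push_cast; ring
      _ ≤ (1 + η) * n := by gcongr
  have upper := (hN' n hNn').2.le
  have lower := (hN' m (hNn'.trans hnm)).1.le
  rw [div_le_iff₀ (hs.apply_pos n)] at upper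
  rw [le_div_iff₀ (hs.apply_pos m), div_mul_eq_mul_div, div_le_iff₀ hκ0] at lower
  have hgm : 0 ≤ g m := nonneg_of_mul_nonneg_left
    ((mul_nonneg hR.le (hs.nonneg m)).trans lower) hκ0
  calc g n ≤ R * κ * h n := upper
    _ ≤ R * κ * (κ * h m) := by gcongr; exact hN n m hNn hnm hmn
    _ = κ ^ 2 * (R * h m) := by ring
    _ ≤ κ ^ 2 * (g m * κ) := by gcongr
    _ = κ ^ 3 * g m := by ring
    _ ≤ c * g m := by gcongr

lemma sum_mul_le (hs : SpitzerSeq h p ρ) (hr : ∀ n, 0 ≤ r n)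
    (hg : ∀ n, g n = ∑ q ∈ antidiagonal n, r q.1 * h q.2) (n : ℕ) : partialSum r n * h n ≤ g n := by
  rw [hg, Nat.sum_antidiagonal_eq_sum_range_succ_mk, partialSum, sum_mul]
  exact sum_le_sum fun k _ => mul_le_mul_of_nonneg_left (hs.anti (Nat.sub_le _ _)) (hr k)

lemma partialSum_conv_le (hs : SpitzerSeq h p ρ) (hr : ∀ n, 0 ≤ r n) (hR : HasSum r R)
    (hg : ∀ n, g n = ∑ q ∈ antidiagonal n, r q.1 * h q.2) (n : ℕ) :
    partialSum g n ≤ R * partialSum h n := by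
  rw [partialSum_conv hg, partialSum_eq_sum_antidiagonal h, mul_sum]
  exact sum_le_sum fun q _ =>
    mul_le_mul_of_nonneg_right (sum_le_hasSum _ (fun i _ => hr i) hR) (hs.nonneg _)

lemma conv_le {C : ℝ} (hs : SpitzerSeq h p ρ) (hr : ∀ n, 0 ≤ r n) (hR : HasSum r R)
    (hg : ∀ n, g n = ∑ q ∈ antidiagonal n, r q.1 * h q.2) (anti : Antitone g)
    (hC : ∀ n : ℕ, partialSum h n ≤ C * ((n + 1) * h n)) (n : ℕ) : g n ≤ C * R * h n := by
  refine le_of_mul_le_mul_left (a := (n + 1 : ℝ)) ?_ (by positivity)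
  calc (n + 1) * g n ≤ partialSum g n := succ_mul_le_partialSum anti n
    _ ≤ R * partialSum h n := hs.partialSum_conv_le hr hR hg n
    _ ≤ R * (C * ((n + 1) * h n)) := mul_le_mul_of_nonneg_left (hC n) (hR.nonneg hr)
    _ = (n + 1) * (C * R * h n) := by ring

lemma eventually_mul_partialSum_sub_le (hs : SpitzerSeq h p ρ) (hR : HasSum r R)
    (hg : ∀ n, g n = ∑ q ∈ antidiagonal n, r q.1 * h q.2) {ε : ℝ} (hε : 0 < ε) :
    ∀ᶠ n in atTop, R * partialSum h n - partialSum g n ≤ ε * partialSum h n := by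
  have tendsto_ratio := tendsto_sum_mul_div_partialSum hs.nonneg hs.anti hs.partialSum_pos
    (hR.tendsto_sum_nat.comp (tendsto_add_atTop_nat 1))
  filter_upwards [tendsto_ratio.eventually_const_lt (sub_lt_self R hε)] with n hn
  rw [lt_div_iff₀ (hs.partialSum_pos n)] at hn
  change _ < ∑ q ∈ antidiagonal n, partialSum r q.1 * h q.2 at hn
  linarith [partialSum_conv hg n]

end SpitzerSeq

/-- Up to rounding, `m / n = 1 + η`. -/
lemma exists_eventually_exists_le_one_add_mul {η : ℝ} (hη : 0 < η) :
    ∃ κ > 0, ∀ N : ℕ, ∀ᶠ m : ℕ in atTop, ∃ n : ℕ, N ≤ n ∧ n < m ∧ (m : ℝ) ≤ (1 + η) * n ∧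
      κ * (m + 1) ≤ (m - n : ℝ) := by
  have hη1 : 0 < 1 + η := by linarith
  obtain ⟨κ, hκ, hκη⟩ : ∃ κ : ℝ, 0 < κ ∧ 2 * κ * (1 + η) = η :=
    ⟨η / (2 * (1 + η)), by positivity, by field_simp⟩
  refine ⟨κ, hκ, fun N => ?_⟩
  filter_upwards [tendsto_natCast_atTop_atTop.eventually_ge_atTop ((1 + η) * N),
    tendsto_natCast_atTop_atTop.eventually_ge_atTop ((1 + κ) / κ)] with m hmN hmκ
  rw [div_le_iff₀ hκ] at hmκ
  have le_ceil := Nat.le_ceil ((m : ℝ) / (1 + η))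
  have ceil_lt : (⌈(m : ℝ) / (1 + η)⌉₊ : ℝ) < m / (1 + η) + 1 :=
    Nat.ceil_lt_add_one (by positivity)
  have div_eq : (m : ℝ) / (1 + η) = m - 2 * κ * m := by
    rw [div_eq_iff hη1.ne']
    linear_combination (m : ℝ) * hκη
  refine ⟨⌈(m : ℝ) / (1 + η)⌉₊, ?_, ?_, ?_, by linarith⟩
  · exact_mod_cast ((le_div_iff₀' hη1).2 hmN).trans le_ceil
  · have : (0 : ℝ) ≤ κ * m := by positivity
    exact_mod_cast (by linarith : (⌈(m : ℝ) / (1 + η)⌉₊ : ℝ) < m)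
  · rwa [div_le_iff₀' hη1] at le_ceil

namespace SpitzerSeq

/-- The monotonicity of `g` turns the asymptotics of its partial sums into an asymptotic upper
bound for `g m`, through the increment of the partial sums between `m / (1 + η)` and `m`. -/
lemma eventually_conv_le (hs : SpitzerSeq h p ρ) (hr : ∀ n, 0 ≤ r n) (hR : HasSum r R)
    (hg : ∀ n, g n = ∑ q ∈ antidiagonal n, r q.1 * h q.2) (anti : Antitone g) {a : ℝ}
    (ha : R < a) : ∀ᶠ m in atTop, g m ≤ a * h m := by
  have hR0 : 0 ≤ R := hR.nonneg hr
  obtain ⟨C, hC1, hC⟩ := hs.exists_partialSum_le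
  obtain ⟨c, hRc, hc⟩ : ∃ c : ℝ, R * c < a ∧ 1 < c :=
    (((continuous_const_mul R).tendsto' 1 R (mul_one R)).mono_left nhdsWithin_le_nhds
      |>.eventually_lt_const ha |>.and (self_mem_nhdsWithin (s := Set.Ioi 1))).exists
  obtain ⟨η, hη, N, hN⟩ := hs.exists_le_mul hc
  obtain ⟨κ, hκ, hκN⟩ := exists_eventually_exists_le_one_add_mul hη
  have hε : 0 < (a - R * c) * κ / C := by have := sub_pos.2 hRc; positivity
  obtain ⟨N', hN'⟩ := eventually_atTop.1 (hs.eventually_mul_partialSum_sub_le hR hg hε)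
  filter_upwards [hκN (max N N')] with m ⟨n, hNn, hnm, hmn, hκm⟩
  obtain ⟨hNn, hNn'⟩ := max_le_iff.1 hNn
  have sub_pos' : (0 : ℝ) < m - n := sub_pos.2 (Nat.cast_lt.2 hnm)
  have error_le : R * partialSum h n - partialSum g n ≤ (m - n) * ((a - R * c) * h m) :=
    calc R * partialSum h n - partialSum g n
        ≤ (a - R * c) * κ / C * partialSum h n := hN' n hNn'
      _ ≤ (a - R * c) * κ / C * (C * ((m + 1) * h m)) :=
        mul_le_mul_of_nonneg_left ((partialSum_mono hs.nonneg hnm.le).trans (hC m)) hε.le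
      _ = κ * (m + 1) * ((a - R * c) * h m) := by field_simp
      _ ≤ (m - n) * ((a - R * c) * h m) := mul_le_mul_of_nonneg_right hκm
        (mul_nonneg (sub_pos.2 hRc).le (hs.nonneg m))
  refine le_of_mul_le_mul_left ?_ sub_pos'
  calc (m - n) * g m ≤ partialSum g m - partialSum g n := sub_mul_le_partialSum_sub anti hnm.le
    _ ≤ R * (partialSum h m - partialSum h n) + (R * partialSum h n - partialSum g n) := by
      linarith [hs.partialSum_conv_le hr hR hg m]
    _ ≤ R * ((m - n) * (c * h m)) + (m - n) * ((a - R * c) * h m) := by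
      have := hN n m hNn hnm.le hmn
      gcongr
      exact (partialSum_sub_le_sub_mul hs.anti hnm.le).trans (by gcongr)
    _ = (m - n) * (a * h m) := by ring

theorem tendsto_conv_div (hs : SpitzerSeq h p ρ) (hr : ∀ n, 0 ≤ r n) (hR : HasSum r R)
    (hg : ∀ n, g n = ∑ q ∈ antidiagonal n, r q.1 * h q.2) (anti : Antitone g) :
    Tendsto (fun n => g n / h n) atTop (𝓝 R) := by
  refine tendsto_order.2 ⟨fun a ha => ?_, fun a ha => ?_⟩
  · filter_upwards [(hR.tendsto_sum_nat.comp (tendsto_add_atTop_nat 1)).eventually_const_lt ha]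
      with n hn
    rw [lt_div_iff₀ (hs.apply_pos n)]
    exact (mul_lt_mul_of_pos_right hn (hs.apply_pos n)).trans_le (hs.sum_mul_le hr hg n)
  · obtain ⟨b, hRb, hba⟩ := exists_between ha
    filter_upwards [hs.eventually_conv_le hr hR hg anti hRb] with n hn
    exact ((div_le_iff₀ (hs.apply_pos n)).2 hn).trans_lt hba

end SpitzerSeq

end Sequences

/-! ### The semiring of finite measures under convolution -/

noncomputable section ConvolutionSemiring

open Set

variable {M : Type*} [MeasurableSpace M]

/-- Finite measures on `M`, as a semiring whose multiplication is convolution. This is a copy of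
`FiniteMeasure M`, so that no multiplication is put on the latter. -/
def ConvMeasure (M : Type*) [MeasurableSpace M] : Type _ := FiniteMeasure M

namespace ConvMeasure

/-- The measure underlying an element of the convolution semiring. -/
def toMeasure (μ : ConvMeasure M) : Measure M := FiniteMeasure.toMeasure μ

/-- A finite measure, as an element of the convolution semiring. -/
def of (μ : Measure M) [IsFiniteMeasure μ] : ConvMeasure M :=
  (⟨μ, inferInstance⟩ : FiniteMeasure M)

@[simp] lemma toMeasure_of (μ : Measure M) [IsFiniteMeasure μ] : (of μ).toMeasure = μ := rfl

instance (μ : ConvMeasure M) : IsFiniteMeasure μ.toMeasure := FiniteMeasure.isFiniteMeasure μ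

lemma toMeasure_injective : Function.Injective (toMeasure (M := M)) :=
  FiniteMeasure.toMeasure_injective

instance : AddCommMonoid (ConvMeasure M) := inferInstanceAs (AddCommMonoid (FiniteMeasure M))

@[simp] lemma toMeasure_add (μ ν : ConvMeasure M) :
    (μ + ν).toMeasure = μ.toMeasure + ν.toMeasure := rfl

@[simp] lemma toMeasure_zero : (0 : ConvMeasure M).toMeasure = 0 := rfl

instance : IsCancelAdd (ConvMeasure M) :=
  have : IsLeftCancelAdd (ConvMeasure M) := ⟨fun μ ν κ h => toMeasure_injective <| by
    ext s _
    have hs := congrArg (fun κ : ConvMeasure M => κ.toMeasure s) h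
    simp only [toMeasure_add, Measure.add_apply] at hs
    exact (ENNReal.add_right_inj (measure_ne_top _ _)).1 hs⟩
  AddCommMagma.IsLeftCancelAdd.toIsCancelAdd _

/-- Restriction of measures to a set. -/
def restrict (s : Set M) : ConvMeasure M →+ ConvMeasure M where
  toFun μ := of (μ.toMeasure.restrict s)
  map_zero' := toMeasure_injective (by simp)
  map_add' _ _ := toMeasure_injective (by simp)

@[simp] lemma toMeasure_restrict (s : Set M) (μ : ConvMeasure M) :
    (restrict s μ).toMeasure = μ.toMeasure.restrict s := rfl

lemma restrict_eq_zero {s : Set M} {μ : ConvMeasure M} :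
    restrict s μ = 0 ↔ μ.toMeasure s = 0 := by
  rw [← toMeasure_injective.eq_iff, toMeasure_restrict, toMeasure_zero, Measure.restrict_eq_zero]

lemma restrict_add_restrict_compl {s : Set M} (hs : MeasurableSet s) (μ : ConvMeasure M) :
    restrict s μ + restrict sᶜ μ = μ :=
  toMeasure_injective (Measure.restrict_add_restrict_compl hs)

lemma restrict_restrict_of_disjoint {s t : Set M} (hs : MeasurableSet s) (hst : Disjoint s t)
    (μ : ConvMeasure M) : restrict s (restrict t μ) = 0 := by
  rw [restrict_eq_zero, toMeasure_restrict, Measure.restrict_apply hs, hst.inter_eq,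
    measure_empty]

variable [AddCommMonoid M]

instance : Mul (ConvMeasure M) := ⟨fun μ ν => of (μ.toMeasure ∗ ν.toMeasure)⟩

@[simp] lemma toMeasure_mul (μ ν : ConvMeasure M) :
    (μ * ν).toMeasure = μ.toMeasure ∗ ν.toMeasure := rfl

instance : One (ConvMeasure M) := ⟨of (Measure.dirac 0)⟩

@[simp] lemma toMeasure_one : (1 : ConvMeasure M).toMeasure = Measure.dirac 0 := rfl

variable [MeasurableAdd₂ M]

instance : CommSemiring (ConvMeasure M) where
  left_distrib μ ν κ := toMeasure_injective
    (Measure.conv_add μ.toMeasure ν.toMeasure κ.toMeasure)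
  right_distrib μ ν κ := toMeasure_injective
    (Measure.add_conv μ.toMeasure ν.toMeasure κ.toMeasure)
  zero_mul _ := toMeasure_injective (Measure.zero_conv _)
  mul_zero _ := toMeasure_injective (Measure.conv_zero _)
  mul_assoc _ _ _ := toMeasure_injective (Measure.conv_assoc _ _ _)
  one_mul _ := toMeasure_injective (Measure.dirac_zero_conv _)
  mul_one _ := toMeasure_injective (Measure.conv_dirac_zero _)
  mul_comm _ _ := toMeasure_injective (Measure.conv_comm _ _)

lemma mul_apply {s : Set M} (hs : MeasurableSet s) (μ ν : ConvMeasure M) :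
    (μ * ν).toMeasure s =
      (μ.toMeasure.prod ν.toMeasure) ((fun z : M × M => z.1 + z.2) ⁻¹' s) := by
  rw [toMeasure_mul, Measure.conv, Measure.map_apply (by fun_prop) hs]

lemma mul_apply_univ (μ ν : ConvMeasure M) :
    (μ * ν).toMeasure univ = μ.toMeasure univ * ν.toMeasure univ := by
  rw [mul_apply MeasurableSet.univ, preimage_univ, ← univ_prod_univ, Measure.prod_prod]

lemma mul_apply_eq_zero {s : Set M} (hs : MeasurableSet s)
    (hadd : ∀ x y, x + y ∈ s → x ∈ s ∨ y ∈ s) {μ ν : ConvMeasure M}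
    (hμ : μ.toMeasure s = 0) (hν : ν.toMeasure s = 0) : (μ * ν).toMeasure s = 0 := by
  rw [mul_apply hs]
  refine measure_mono_null (t := s ×ˢ univ ∪ univ ×ˢ s) ?_ (measure_union_null ?_ ?_)
  · rintro ⟨x, y⟩ hxy
    rcases hadd x y hxy with hx | hy
    · exact Or.inl ⟨hx, trivial⟩
    · exact Or.inr ⟨trivial, hy⟩
  · rw [Measure.prod_prod, hμ, zero_mul]
  · rw [Measure.prod_prod, hν, mul_zero]

/-- Total mass, as a semiring homomorphism. -/
def mass : ConvMeasure M →+* ℝ where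
  toFun μ := μ.toMeasure.real univ
  map_zero' := by simp
  map_one' := by simp
  map_add' _ _ := by simp [measureReal_add_apply]
  map_mul' μ ν := by rw [Measure.real, mul_apply_univ, ENNReal.toReal_mul]; rfl

lemma mass_apply (μ : ConvMeasure M) : mass μ = μ.toMeasure.real univ := rfl

lemma isSplitting [LinearOrder M] [IsOrderedCancelAddMonoid M] [TopologicalSpace M]
    [OrderClosedTopology M] [OpensMeasurableSpace M] :
    IsSplitting (restrict (Ici (0 : M))) (restrict (Iio 0)) where
  add_eq μ := by rw [← compl_Ici, restrict_add_restrict_compl measurableSet_Ici]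
  right_left :=
    restrict_restrict_of_disjoint measurableSet_Iio (Iio_disjoint_Ici le_rfl)
  left_right :=
    restrict_restrict_of_disjoint measurableSet_Ici (Iio_disjoint_Ici le_rfl).symm
  right_mul μ ν := by
    simp only [restrict_eq_zero]
    refine mul_apply_eq_zero measurableSet_Iio fun x y hxy => ?_
    contrapose! hxy
    simpa using add_nonneg (not_lt.1 hxy.1) (not_lt.1 hxy.2)
  left_mul μ ν := by
    simp only [restrict_eq_zero]
    refine mul_apply_eq_zero measurableSet_Ici fun x y hxy => ?_
    contrapose! hxy
    simpa using add_neg (not_le.1 hxy.1) (not_le.1 hxy.2)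
  right_one := by
    rw [restrict_eq_zero, toMeasure_one, Measure.dirac_apply' _ measurableSet_Iio,
      indicator_of_notMem self_notMem_Iio]

end ConvMeasure

end ConvolutionSemiring

/-! ### The random walk killed on leaving the half-line -/

noncomputable section Walk

open Set ConvMeasure
open Finset.HasAntidiagonal (antidiagonal)

variable {F : Measure ℝ}

/-- The transition operator of the random walk with step law `F`, killed on leaving `[0, ∞)`. -/
def walkOp (F : Measure ℝ) (f : ℝ → ℝ≥0∞) (x : ℝ) : ℝ≥0∞ :=
  ∫⁻ y, (Ici 0).indicator f (x + y) ∂F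

/-- The probability that the walk started at `x ≥ 0` stays nonnegative up to time `n`. For `x < 0`
the starting point is not tested, which makes the function measurable and monotone on `ℝ`. -/
def survival (F : Measure ℝ) : ℕ → ℝ → ℝ≥0∞
  | 0 => fun _ => 1
  | n + 1 => walkOp F (survival F n)

lemma measurable_indicator_Ici_add {f : ℝ → ℝ≥0∞} (hf : Measurable f) (x : ℝ) :
    Measurable fun y => (Ici 0).indicator f (x + y) :=
  (hf.indicator measurableSet_Ici).comp (measurable_const_add x)

lemma measurable_walkOp [SFinite F] {f : ℝ → ℝ≥0∞} (hf : Measurable f) :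
    Measurable (walkOp F f) :=
  Measurable.lintegral_prod_right' (f := fun p : ℝ × ℝ => (Ici 0).indicator f (p.1 + p.2))
    ((hf.indicator measurableSet_Ici).comp measurable_add)

lemma walkOp_le_walkOp {f g : ℝ → ℝ≥0∞} (h : ∀ x, 0 ≤ x → f x ≤ g x) (x : ℝ) :
    walkOp F f x ≤ walkOp F g x :=
  lintegral_mono fun _ => indicator_le_indicator' fun hy => h _ hy

lemma walkOp_congr {f g : ℝ → ℝ≥0∞} (h : ∀ x, 0 ≤ x → f x = g x) : walkOp F f = walkOp F g :=
  funext fun x => le_antisymm (walkOp_le_walkOp (fun y hy => (h y hy).le) x)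
    (walkOp_le_walkOp (fun y hy => (h y hy).ge) x)

lemma monotone_walkOp {f : ℝ → ℝ≥0∞} (hf : Monotone f) : Monotone (walkOp F f) := by
  intro x x' hx
  refine lintegral_mono fun y => ?_
  have hxy : x + y ≤ x' + y := by gcongr
  by_cases hy : x + y ∈ Ici 0
  · rw [indicator_of_mem hy, indicator_of_mem (mem_Ici.2 (le_trans hy hxy))]
    exact hf hxy
  · rw [indicator_of_notMem hy]
    exact zero_le

lemma survival_mono (n : ℕ) : Monotone (survival F n) := by
  induction n with
  | zero => exact monotone_const
  | succ n ih => exact monotone_walkOp ih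

lemma walkOp_sum_mul {ι : Type*} (s : Finset ι) {f : ι → ℝ → ℝ≥0∞} (hf : ∀ i, Measurable (f i))
    (c : ι → ℝ≥0∞) (x : ℝ) :
    walkOp F (fun y => ∑ i ∈ s, f i y * c i) x = ∑ i ∈ s, walkOp F (f i) x * c i := by
  have hm i := measurable_indicator_Ici_add (hf i) x
  simp_rw [walkOp, ← lintegral_mul_const _ (hm _)]
  rw [← lintegral_finsetSum _ fun i _ => (hm i).mul_const _]
  refine lintegral_congr fun y => ?_
  by_cases hy : 0 ≤ x + y <;> simp [indicator, hy]

lemma walkOp_tsum {f : ℕ → ℝ → ℝ≥0∞} (hf : ∀ n, Measurable (f n)) (x : ℝ) :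
    walkOp F (fun y => ∑' n, f n y) x = ∑' n, walkOp F (f n) x := by
  simp only [walkOp]
  rw [← lintegral_tsum fun n => (measurable_indicator_Ici_add (hf n) x).aemeasurable]
  refine lintegral_congr fun y => ?_
  by_cases hy : 0 ≤ x + y <;> simp [indicator, hy]

lemma mul_le_walkOp {f : ℝ → ℝ≥0∞} (hf : Monotone f) {δ x : ℝ} (hx : 0 ≤ x + δ) :
    F (Ici δ) * f (x + δ) ≤ walkOp F f x := by
  calc F (Ici δ) * f (x + δ) = ∫⁻ _ in Ici δ, f (x + δ) ∂F := by rw [setLIntegral_const, mul_comm]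
    _ ≤ ∫⁻ t in Ici δ, (Ici 0).indicator f (x + t) ∂F := by
        refine setLIntegral_mono' measurableSet_Ici fun t ht => ?_
        have hxt : x + δ ≤ x + t := by gcongr; exact ht
        rw [indicator_of_mem (mem_Ici.2 (hx.trans hxt))]
        exact hf hxt
    _ ≤ walkOp F f x := setLIntegral_le_lintegral _ _

/-- The walk may start with `j` steps of size at least `δ`. -/
lemma pow_mul_survival_le {δ : ℝ} (hδ : 0 ≤ δ) (n j : ℕ) {y : ℝ} (hy : 0 ≤ y) :
    F (Ici δ) ^ j * survival F n (y + j * δ) ≤ survival F (n + j) y := by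
  induction j generalizing y with
  | zero => simp
  | succ j ih =>
    have hyδ : 0 ≤ y + δ := add_nonneg hy hδ
    calc F (Ici δ) ^ (j + 1) * survival F n (y + (j + 1 : ℕ) * δ)
        = F (Ici δ) * (F (Ici δ) ^ j * survival F n ((y + δ) + j * δ)) := by
          rw [pow_succ', mul_assoc]
          congr 3
          push_cast
          ring
      _ ≤ F (Ici δ) * survival F (n + j) (y + δ) := by gcongr; exact ih hyδ
      _ ≤ survival F (n + (j + 1)) y := mul_le_walkOp (survival_mono _) hyδ

lemma exists_measure_Ici_ne_zero (hF : F (Ioi 0) ≠ 0) : ∃ δ > 0, F (Ici δ) ≠ 0 := by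
  by_contra! h
  refine hF (measure_mono_null (t := ⋃ n : ℕ, Ici (1 / (n + 1 : ℝ))) (fun x hx => ?_)
    (measure_iUnion_null fun n => h _ Nat.one_div_pos_of_nat))
  obtain ⟨n, hn⟩ := exists_nat_one_div_lt (mem_Ioi.1 hx)
  exact mem_iUnion.2 ⟨n, hn.le⟩

lemma survival_ne_zero (hF : F (Ioi 0) ≠ 0) (n : ℕ) {x : ℝ} (hx : 0 ≤ x) :
    survival F n x ≠ 0 := by
  obtain ⟨δ, hδ, hFδ⟩ := exists_measure_Ici_ne_zero hF
  have hle := pow_mul_survival_le (F := F) hδ.le 0 n hx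
  rw [survival, mul_one, zero_add] at hle
  exact fun h0 => pow_ne_zero n hFδ (le_zero_iff.1 (h0 ▸ hle))

lemma measurable_survival (n : ℕ) : Measurable (survival F n) :=
  (survival_mono n).measurable

variable [IsProbabilityMeasure F]

lemma survival_succ_le (n : ℕ) (x : ℝ) : survival F (n + 1) x ≤ survival F n x := by
  induction n generalizing x with
  | zero =>
    calc survival F 1 x ≤ ∫⁻ _, 1 ∂F :=
          lintegral_mono fun y => indicator_le_self' (fun _ _ => zero_le) _
      _ = 1 := by rw [lintegral_one, measure_univ]
  | succ n ih => exact walkOp_le_walkOp (fun y _ => ih y) x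

lemma survival_antitone (x : ℝ) : Antitone fun n => survival F n x :=
  antitone_nat_of_succ_le fun n => survival_succ_le n x

lemma survival_le_one (n : ℕ) (x : ℝ) : survival F n x ≤ 1 := survival_antitone x (Nat.zero_le n)

lemma survival_ne_top (n : ℕ) (x : ℝ) : survival F n x ≠ ∞ :=
  ne_top_of_le_ne_top ENNReal.one_ne_top (survival_le_one n x)

lemma exists_survival_le_mul_survival_zero (hF : F (Ioi 0) ≠ 0) (x : ℝ) :
    ∃ C : ℝ≥0∞, C ≠ ∞ ∧ ∀ n, survival F n x ≤ C * survival F n 0 := by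
  obtain ⟨δ, hδ, hFδ⟩ := exists_measure_Ici_ne_zero hF
  obtain ⟨j, hj⟩ := exists_nat_ge (x / δ)
  rw [div_le_iff₀ hδ] at hj
  have hpow : F (Ici δ) ^ j ≠ 0 := pow_ne_zero _ hFδ
  refine ⟨(F (Ici δ) ^ j)⁻¹, ENNReal.inv_ne_top.2 hpow, fun n => ?_⟩
  rw [mul_comm, ← div_eq_mul_inv, ENNReal.le_div_iff_mul_le (Or.inl hpow)
    (Or.inl (ENNReal.pow_ne_top (measure_ne_top _ _))), mul_comm]
  calc F (Ici δ) ^ j * survival F n x ≤ F (Ici δ) ^ j * survival F n (0 + j * δ) := by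
        gcongr; exact survival_mono n (by rwa [zero_add])
    _ ≤ survival F (n + j) 0 := pow_mul_survival_le hδ.le n j le_rfl
    _ ≤ survival F n 0 := survival_antitone 0 (Nat.le_add_right _ _)

section WienerHopf

variable (F)

/-- The law of the walk started at `0`, killed on leaving `[0, ∞)`. -/
def stayLaw (n : ℕ) : ConvMeasure ℝ := killedPow (restrict (Ici 0)) (of F) n

/-- The law of the walk started at `0`, killed on returning to `[0, ∞)`. By time reversal it is
also the law of the walk at time `n` on the event that `n` is a strictly descending ladder time. -/
def belowLaw (n : ℕ) : ConvMeasure ℝ := killedPow (restrict (Iio 0)) (of F) n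

/-- The mass that the walk killed on returning to `[0, ∞)` gives to `[-x, ∞)` at time `n`: the
contribution of time `n` to the renewal function at `x`. -/
def ladderMass (n : ℕ) (x : ℝ) : ℝ≥0∞ := (belowLaw F n).toMeasure (Ici (-x))

/-- The probability that the walk started at `0` first returns to `[0, ∞)` at time `n + 1`. -/
def returnMass (n : ℕ) : ℝ≥0∞ := (belowLaw F n * of F).toMeasure (Ici 0)

/-- The renewal function of the strictly descending ladder heights of the walk. -/
def renewalFn (x : ℝ) : ℝ≥0∞ := ∑' n, ladderMass F n x

variable {F}

lemma lintegral_walkOp (μ : ConvMeasure ℝ) {f : ℝ → ℝ≥0∞} (hf : Measurable f) :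
    ∫⁻ x, walkOp F f x ∂μ.toMeasure = ∫⁻ x, f x ∂(restrict (Ici 0) (μ * of F)).toMeasure := by
  rw [toMeasure_restrict, ← lintegral_indicator measurableSet_Ici, toMeasure_mul, toMeasure_of,
    Measure.lintegral_conv (hf.indicator measurableSet_Ici)]
  rfl

lemma lintegral_survival_stayLaw (m n : ℕ) :
    ∫⁻ x, survival F m x ∂(stayLaw F n).toMeasure = (stayLaw F (n + m)).toMeasure univ := by
  induction m generalizing n with
  | zero => rw [survival, lintegral_one, add_zero]
  | succ m ih =>
    rw [survival, lintegral_walkOp _ (measurable_survival m)]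
    exact (ih (n + 1)).trans (by rw [Nat.succ_add_eq_add_succ])

lemma survival_zero_right (n : ℕ) : survival F n 0 = (stayLaw F n).toMeasure univ := by
  rw [← zero_add n, ← lintegral_survival_stayLaw, stayLaw, killedPow, toMeasure_one,
    lintegral_dirac' _ (measurable_survival _), zero_add]

lemma belowLaw_zero : belowLaw F 0 = 1 := rfl

lemma belowLaw_Ioi (n : ℕ) : (belowLaw F n).toMeasure (Ioi 0) = 0 := by
  cases n with
  | zero => simp [belowLaw_zero]
  | succ n =>
    rw [belowLaw, killedPow, toMeasure_restrict, Measure.restrict_apply measurableSet_Ioi,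
      Ioi_inter_Iio, Ioo_self, measure_empty]

lemma measurable_ladderMass (n : ℕ) : Measurable (ladderMass F n) :=
  Monotone.measurable fun _ _ hxy => measure_mono (Ici_subset_Ici.2 (neg_le_neg hxy))

lemma ladderMass_of_neg (n : ℕ) {x : ℝ} (hx : x < 0) : ladderMass F n x = 0 :=
  measure_mono_null (Ici_subset_Ioi.2 (neg_pos.2 hx)) (belowLaw_Ioi n)

lemma indicator_Ici_ladderMass (n : ℕ) : (Ici 0).indicator (ladderMass F n) = ladderMass F n :=
  indicator_eq_self.2 <| Function.support_subset_iff'.2 fun _ hx =>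
    ladderMass_of_neg n (not_le.1 hx)

lemma ladderMass_zero {x : ℝ} (hx : 0 ≤ x) : ladderMass F 0 x = 1 := by
  simp [ladderMass, belowLaw_zero, hx]

lemma walkOp_ladderMass_eq (n : ℕ) (x : ℝ) :
    walkOp F (ladderMass F n) x = (belowLaw F n * of F).toMeasure (Ici (-x)) := by
  rw [mul_comm, mul_apply measurableSet_Ici, Measure.prod_apply (measurable_add measurableSet_Ici),
    walkOp, indicator_Ici_ladderMass, toMeasure_of]
  refine lintegral_congr fun y => congrArg (belowLaw F n).toMeasure (Set.ext fun z => ?_)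
  simp only [mem_Ici, mem_preimage]
  constructor <;> intro <;> linarith

lemma belowLaw_mul_of_apply (n : ℕ) {s : Set ℝ} (hs : Ici 0 ⊆ s) (hms : MeasurableSet s) :
    (belowLaw F n * of F).toMeasure s = (belowLaw F (n + 1)).toMeasure s + returnMass F n := by
  have hsplit := congrArg (fun μ : ConvMeasure ℝ => μ.toMeasure s)
    (isSplitting.add_eq (belowLaw F n * of F))
  simp only [toMeasure_add, Measure.add_apply, toMeasure_restrict] at hsplit
  rw [Measure.restrict_apply hms, inter_eq_right.2 hs] at hsplit
  rw [← hsplit, add_comm]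
  rfl

lemma walkOp_ladderMass (n : ℕ) {x : ℝ} (hx : 0 ≤ x) :
    walkOp F (ladderMass F n) x = ladderMass F (n + 1) x + returnMass F n := by
  rw [walkOp_ladderMass_eq, ladderMass,
    belowLaw_mul_of_apply n (Ici_subset_Ici.2 (neg_nonpos.2 hx)) measurableSet_Ici]

lemma belowLaw_univ (n : ℕ) : (belowLaw F n).toMeasure univ =
    (belowLaw F (n + 1)).toMeasure univ + returnMass F n := by
  rw [← belowLaw_mul_of_apply n (subset_univ _) MeasurableSet.univ, mul_apply_univ, toMeasure_of,
    measure_univ (μ := F), mul_one]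

lemma sum_survival_mul_belowLaw (n : ℕ) :
    ∑ q ∈ antidiagonal n, survival F q.1 0 * (belowLaw F q.2).toMeasure univ = 1 := by
  have hsum := congrArg mass (isSplitting.sum_killedPow_mul_killedPow (of F) n)
  simp only [map_sum, map_pow, map_mul, mass_apply, toMeasure_of, probReal_univ, one_pow] at hsum
  rw [← ENNReal.toReal_eq_one_iff, ENNReal.toReal_sum, ← hsum]
  · refine Finset.sum_congr rfl fun q _ => ?_
    rw [ENNReal.toReal_mul, survival_zero_right]
    rfl
  · exact fun q _ => ENNReal.mul_ne_top (survival_ne_top _ _) (measure_ne_top _ _)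

lemma sum_survival_mul_returnMass (n : ℕ) :
    ∑ q ∈ antidiagonal n, survival F q.1 0 * returnMass F q.2 = survival F (n + 1) 0 := by
  have hn := sum_survival_mul_belowLaw (F := F) n
  simp_rw [fun q : ℕ × ℕ => belowLaw_univ (F := F) q.2, mul_add, Finset.sum_add_distrib] at hn
  have hsucc := sum_survival_mul_belowLaw (F := F) (n + 1)
  rw [Finset.Nat.sum_antidiagonal_succ', ← hn, belowLaw_zero, toMeasure_one,
    measure_univ (μ := Measure.dirac 0), mul_one, add_comm, ENNReal.add_right_inj] at hsucc
  · exact hsucc.symm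
  · exact ENNReal.sum_ne_top.2 fun q _ =>
      ENNReal.mul_ne_top (survival_ne_top _ _) (measure_ne_top _ _)

/-- Decomposition of the walk at its minimum. -/
lemma survival_eq_sum (n : ℕ) {x : ℝ} (hx : 0 ≤ x) :
    survival F n x = ∑ q ∈ antidiagonal n, ladderMass F q.1 x * survival F q.2 0 := by
  induction n generalizing x with
  | zero => simp [ladderMass_zero hx, survival]
  | succ n ih =>
    rw [survival, walkOp_congr fun y hy => ih hy, Finset.Nat.sum_antidiagonal_succ,
      ladderMass_zero hx, one_mul, walkOp_sum_mul _ fun q : ℕ × ℕ => measurable_ladderMass q.1,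
      ← sum_survival_mul_returnMass,
      ← Finset.Nat.sum_antidiagonal_swap (f := fun q => survival F q.1 0 * returnMass F q.2),
      ← Finset.sum_add_distrib]
    refine Finset.sum_congr rfl fun q _ => ?_
    rw [walkOp_ladderMass _ hx, add_mul, add_comm, mul_comm (returnMass F _)]
    rfl

lemma sum_ladderMass_mul_survival_le (n : ℕ) {x : ℝ} (hx : 0 ≤ x) :
    (∑ k ∈ Finset.range n, ladderMass F k x) * survival F n 0 ≤ survival F n x := by
  rw [survival_eq_sum n hx, Finset.Nat.sum_antidiagonal_eq_sum_range_succ_mk, Finset.sum_mul]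
  calc ∑ k ∈ Finset.range n, ladderMass F k x * survival F n 0
      ≤ ∑ k ∈ Finset.range n, ladderMass F k x * survival F (n - k) 0 := by
        gcongr
        exact survival_antitone 0 (Nat.sub_le _ _)
    _ ≤ ∑ k ∈ Finset.range (n + 1), ladderMass F k x * survival F (n - k) 0 :=
        Finset.sum_le_sum_of_subset (Finset.range_subset_range.2 n.le_succ)

lemma one_le_renewalFn {x : ℝ} (hx : 0 ≤ x) : 1 ≤ renewalFn F x :=
  (ladderMass_zero (F := F) hx).ge.trans (ENNReal.le_tsum 0)

lemma measurable_renewalFn : Measurable (renewalFn F) :=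
  Measurable.tsum measurable_ladderMass

lemma renewalFn_ne_top (hF : F (Ioi 0) ≠ 0) {x : ℝ} (hx : 0 ≤ x) : renewalFn F x ≠ ∞ := by
  obtain ⟨C, hC, hle⟩ := exists_survival_le_mul_survival_zero hF x
  refine ne_top_of_le_ne_top hC ?_
  rw [renewalFn, ENNReal.tsum_eq_iSup_nat]
  refine iSup_le fun n => ?_
  rw [← ENNReal.mul_le_mul_iff_left (survival_ne_zero hF n le_rfl) (survival_ne_top n 0)]
  exact (sum_ladderMass_mul_survival_le n hx).trans (hle n)

lemma sum_returnMass (n : ℕ) :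
    ∑ k ∈ Finset.range n, returnMass F k + (belowLaw F n).toMeasure univ = 1 := by
  induction n with
  | zero => simp [belowLaw_zero]
  | succ n ih =>
    rw [← ih, Finset.sum_range_succ, belowLaw_univ n, add_assoc, add_comm (returnMass F n)]

lemma tsum_returnMass (h : Tendsto (fun n => (belowLaw F n).toMeasure univ) atTop (𝓝 0)) :
    ∑' n, returnMass F n = 1 := by
  have hlim := (ENNReal.tendsto_nat_tsum (returnMass F)).add h
  simp only [sum_returnMass, add_zero] at hlim
  exact tendsto_nhds_unique hlim tendsto_const_nhds

lemma walkOp_renewalFn (h : Tendsto (fun n => (belowLaw F n).toMeasure univ) atTop (𝓝 0)) {x : ℝ}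
    (hx : 0 ≤ x) : walkOp F (renewalFn F) x = renewalFn F x := by
  calc walkOp F (renewalFn F) x
      = ∑' n, (ladderMass F (n + 1) x + returnMass F n) := by
        simp_rw [← walkOp_ladderMass _ hx]
        exact walkOp_tsum measurable_ladderMass x
    _ = renewalFn F x := by
        rw [ENNReal.tsum_add, tsum_returnMass h, renewalFn,
          tsum_eq_zero_add' (f := fun n => ladderMass F n x) ENNReal.summable, ladderMass_zero hx,
          add_comm]

end WienerHopf

end Walk

/-! ### Walks satisfying Spitzer's condition -/

noncomputable section SpitzerCondition

open Set ConvMeasure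
open Finset.HasAntidiagonal (antidiagonal)

/-- A nondegenerate form of Spitzer's condition on the step law `F` of a random walk: the
probability that the walk is nonnegative at time `n` converges to `ρ > 0`, and the walk can go up.
Its law at time `n` is the convolution power `of F ^ n`. -/
structure SpitzerLaw (F : Measure ℝ) [IsProbabilityMeasure F] (ρ : ℝ) : Prop where
  measure_Ioi_ne_zero : F (Ioi 0) ≠ 0
  tendsto : Tendsto (fun n : ℕ => (of F ^ n).toMeasure.real (Ici 0)) atTop (𝓝 ρ)
  pos : 0 < ρ

section CentralLimit

/-- A centered law on `ℝ` with positive finite variance. -/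
structure CenteredLaw (F : Measure ℝ) : Prop where
  integral_eq_zero : ∫ y, y ∂F = 0
  integrable_sq : Integrable (fun y => y ^ 2) F
  integral_sq_pos : 0 < ∫ y, y ^ 2 ∂F

variable {F : Measure ℝ} [IsProbabilityMeasure F]

instance isProbabilityMeasure_pow (n : ℕ) : IsProbabilityMeasure (of F ^ n).toMeasure := by
  induction n with
  | zero => rw [pow_zero, toMeasure_one]; infer_instance
  | succ n ih => rw [pow_succ, toMeasure_mul, toMeasure_of]; infer_instance

lemma charFun_pow (n : ℕ) (t : ℝ) : charFun (of F ^ n).toMeasure t = charFun F t ^ n := by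
  induction n with
  | zero => rw [pow_zero, toMeasure_one, charFun_dirac, inner_zero_left]; simp
  | succ n ih => rw [pow_succ, toMeasure_mul, charFun_conv, ih, toMeasure_of, pow_succ]

lemma charFun_gaussianReal_zero_one (t : ℝ) :
    charFun (gaussianReal 0 1) t = Complex.exp (-(t : ℂ) ^ 2 / 2) := by
  rw [charFun_gaussianReal]
  congr 1
  push_cast
  ring

lemma gaussianReal_real_Ici_pos : 0 < (gaussianReal 0 1).real (Ici 0) := by
  refine ENNReal.toReal_pos (fun h => ?_) (measure_ne_top _ _)
  have := gaussianReal_absolutelyContinuous' 0 one_ne_zero h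
  simp at this

namespace CenteredLaw

lemma integrable (hF : CenteredLaw F) : Integrable (fun y => y) F :=
  ((memLp_two_iff_integrable_sq measurable_id.aestronglyMeasurable).2 hF.integrable_sq).integrable
    one_le_two

lemma measure_Ioi_ne_zero (hF : CenteredLaw F) : F (Ioi 0) ≠ 0 := by
  intro h0
  have nonpos : ∀ᵐ y ∂F, 0 ≤ -y := by
    filter_upwards [measure_eq_zero_iff_ae_notMem.1 h0] with y hy
    exact neg_nonneg.2 (not_lt.1 hy)
  have ae_zero : (fun y : ℝ => -y) =ᵐ[F] 0 :=
    (integral_eq_zero_iff_of_nonneg_ae nonpos hF.integrable.neg).1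
      (by rw [integral_neg, hF.integral_eq_zero, neg_zero])
  refine hF.integral_sq_pos.ne' (integral_eq_zero_of_ae ?_)
  filter_upwards [ae_zero] with y hy
  simpa using hy

lemma tendsto_charFun_map_pow (hF : CenteredLaw F) (t : ℝ) :
    Tendsto (fun n : ℕ => charFun ((of F ^ n).toMeasure.map
      (fun y => (√(∫ y, y ^ 2 ∂F))⁻¹ * (√n)⁻¹ * y)) t) atTop
      (𝓝 (charFun (gaussianReal 0 1) t)) := by
  set σ := √(∫ y, y ^ 2 ∂F)
  have hσ : σ ^ 2 = ∫ y, y ^ 2 ∂F := Real.sq_sqrt hF.integral_sq_pos.le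
  have variance_one : ∫ y, (σ⁻¹ * y) ^ 2 ∂F = 1 := by
    simp only [mul_pow]
    rw [integral_const_mul, ← hσ, inv_pow, inv_mul_cancel₀]
    rw [hσ]
    exact hF.integral_sq_pos.ne'
  rw [charFun_gaussianReal_zero_one]
  refine (tendsto_charFun_inv_sqrt_mul_pow (P := F) (X := fun y => σ⁻¹ * y) (by fun_prop)
    (by rw [integral_const_mul, hF.integral_eq_zero, mul_zero]) variance_one t).congr fun n => ?_
  rw [charFun_map_mul, charFun_map_mul, charFun_pow, mul_assoc]

lemma tendsto_pow_Ici (hF : CenteredLaw F) :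
    Tendsto (fun n : ℕ => (of F ^ n).toMeasure (Ici 0)) atTop
      (𝓝 (gaussianReal 0 1 (Ici 0))) := by
  set σ := √(∫ y, y ^ 2 ∂F)
  let scaled (n : ℕ) : ProbabilityMeasure ℝ :=
    ⟨(of F ^ n).toMeasure.map (fun y => σ⁻¹ * (√n)⁻¹ * y),
      Measure.isProbabilityMeasure_map (by fun_prop)⟩
  let gaussian : ProbabilityMeasure ℝ := ⟨gaussianReal 0 1, inferInstance⟩
  have tendsto_scaled : Tendsto scaled atTop (𝓝 gaussian) :=
    ProbabilityMeasure.tendsto_iff_tendsto_charFun.2 hF.tendsto_charFun_map_pow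
  have frontier_null : gaussianReal 0 1 (frontier (Ici 0)) = 0 := by
    have := nullSingletonClass_gaussianReal (μ := 0) (v := 1) one_ne_zero
    rw [frontier_Ici, measure_singleton]
  refine (ProbabilityMeasure.tendsto_measure_of_null_frontier_of_tendsto' tendsto_scaled
    frontier_null).congr' ?_
  filter_upwards [eventually_gt_atTop 0] with n hn
  have scale_pos : 0 < σ⁻¹ * (√n)⁻¹ := mul_pos (inv_pos.2 (Real.sqrt_pos.2 hF.integral_sq_pos))
    (inv_pos.2 (Real.sqrt_pos.2 (Nat.cast_pos.2 hn)))
  change ((of F ^ n).toMeasure.map fun y => σ⁻¹ * (√n)⁻¹ * y) (Ici 0) = _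
  rw [Measure.map_apply (by fun_prop) measurableSet_Ici]
  exact congrArg _ (Set.ext fun y => mul_nonneg_iff_of_pos_left scale_pos)

theorem spitzerLaw (hF : CenteredLaw F) : SpitzerLaw F ((gaussianReal 0 1).real (Ici 0)) where
  measure_Ioi_ne_zero := hF.measure_Ioi_ne_zero
  tendsto := (ENNReal.tendsto_toReal (measure_ne_top _ _)).comp hF.tendsto_pow_Ici
  pos := gaussianReal_real_Ici_pos

end CenteredLaw

end CentralLimit

variable {F : Measure ℝ} [IsProbabilityMeasure F] {ρ : ℝ}

lemma ladderMass_ne_top (n : ℕ) (x : ℝ) : ladderMass F n x ≠ ∞ := measure_ne_top _ _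

lemma belowLaw_univ_antitone : Antitone fun n => (belowLaw F n).toMeasure univ :=
  antitone_nat_of_succ_le fun n => by rw [belowLaw_univ n]; exact le_self_add

lemma sum_survival_mul_belowLaw_le (n : ℕ) :
    (∑ k ∈ Finset.range (n + 1), survival F k 0) * (belowLaw F n).toMeasure univ ≤ 1 := by
  rw [← sum_survival_mul_belowLaw (F := F) n, Finset.Nat.sum_antidiagonal_eq_sum_range_succ_mk,
    Finset.sum_mul]
  exact Finset.sum_le_sum fun k _ =>
    mul_le_mul_right (belowLaw_univ_antitone (F := F) (Nat.sub_le n k)) _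

lemma toReal_survival_mono (n : ℕ) : Monotone fun x => (survival F n x).toReal :=
  fun _ _ hxy => ENNReal.toReal_mono (survival_ne_top _ _) (survival_mono n hxy)

lemma toReal_survival_antitone (x : ℝ) : Antitone fun n => (survival F n x).toReal :=
  fun _ _ hmn => ENNReal.toReal_mono (survival_ne_top _ _) (survival_antitone x hmn)

lemma toReal_survival_eq_sum (n : ℕ) {x : ℝ} (hx : 0 ≤ x) :
    (survival F n x).toReal =
      ∑ q ∈ antidiagonal n, (ladderMass F q.1 x).toReal * (survival F q.2 0).toReal := by
  rw [survival_eq_sum n hx, ENNReal.toReal_sum fun q _ =>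
    ENNReal.mul_ne_top (ladderMass_ne_top _ _) (survival_ne_top _ _)]
  simp only [ENNReal.toReal_mul]

lemma toReal_survival_pos (hF : F (Ioi 0) ≠ 0) (n : ℕ) {x : ℝ} (hx : 0 ≤ x) :
    0 < (survival F n x).toReal :=
  ENNReal.toReal_pos (survival_ne_zero hF n hx) (survival_ne_top n x)

lemma one_le_toReal_renewalFn (hF : F (Ioi 0) ≠ 0) {x : ℝ} (hx : 0 ≤ x) :
    1 ≤ (renewalFn F x).toReal :=
  (ENNReal.ofReal_le_iff_le_toReal (renewalFn_ne_top hF hx)).1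
    (ENNReal.ofReal_one.trans_le (one_le_renewalFn hx))

lemma hasSum_ladderMass (hF : F (Ioi 0) ≠ 0) {x : ℝ} (hx : 0 ≤ x) :
    HasSum (fun n => (ladderMass F n x).toReal) (renewalFn F x).toReal := by
  rw [renewalFn, ENNReal.tsum_toReal_eq fun n => ladderMass_ne_top n x]
  exact ENNReal.hasSum_toReal (renewalFn_ne_top hF hx)

namespace SpitzerLaw

lemma spitzerSeq (hF : SpitzerLaw F ρ) :
    SpitzerSeq (fun n => (survival F n 0).toReal) (fun n => (of F ^ n).toMeasure.real (Ici 0))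
      ρ where
  zero := by rw [survival, ENNReal.toReal_one]
  anti := toReal_survival_antitone 0
  nonneg _ := ENNReal.toReal_nonneg
  succ_mul_eq n := by
    have spitzer := congrArg mass (isSplitting.succ_mul_killedPow_succ (of F) n)
    simp only [map_sum, map_mul, map_add, map_one, map_natCast, mass_apply, toMeasure_restrict,
      measureReal_restrict_apply_univ] at spitzer
    simp only [survival_zero_right]
    exact spitzer
  tendsto := hF.tendsto
  pos := hF.pos

lemma tendsto_belowLaw (hF : SpitzerLaw F ρ) :
    Tendsto (fun n => (belowLaw F n).toMeasure univ) atTop (𝓝 0) := by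
  have sum_eq (n : ℕ) : ∑ k ∈ Finset.range (n + 1), survival F k 0 =
      ENNReal.ofReal (partialSum (fun n => (survival F n 0).toReal) n) := by
    rw [partialSum, ENNReal.ofReal_sum_of_nonneg fun _ _ => ENNReal.toReal_nonneg]
    simp only [ENNReal.ofReal_toReal (survival_ne_top _ _)]
  have tendsto_inv : Tendsto (fun n => (∑ k ∈ Finset.range (n + 1), survival F k 0)⁻¹)
      atTop (𝓝 0) := by
    simp only [sum_eq]
    exact ENNReal.inv_top ▸ (ENNReal.tendsto_ofReal_atTop.comp hF.spitzerSeq.tendsto_partialSum).inv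
  refine tendsto_of_tendsto_of_tendsto_of_le_of_le tendsto_const_nhds tendsto_inv
    (fun _ => zero_le) fun n => ?_
  rw [ENNReal.le_inv_iff_mul_le, mul_comm]
  exact sum_survival_mul_belowLaw_le n

lemma walkOp_renewalFn (hF : SpitzerLaw F ρ) {x : ℝ} (hx : 0 ≤ x) :
    walkOp F (renewalFn F) x = renewalFn F x :=
  SpinalBRW.walkOp_renewalFn hF.tendsto_belowLaw hx

lemma tendsto_survival_div (hF : SpitzerLaw F ρ) {x : ℝ} (hx : 0 ≤ x) :
    Tendsto (fun n => (survival F n x).toReal / (survival F n 0).toReal) atTop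
      (𝓝 (renewalFn F x).toReal) :=
  hF.spitzerSeq.tendsto_conv_div (fun _ => ENNReal.toReal_nonneg)
    (hasSum_ladderMass hF.measure_Ioi_ne_zero hx) (fun n => toReal_survival_eq_sum n hx)
    (toReal_survival_antitone x)

lemma exists_survival_div_le (hF : SpitzerLaw F ρ) (q : ℕ) :
    ∃ C : ℝ, ∀ n m : ℕ, n ≤ q * (m + 1) → ∀ x y : ℝ, 0 ≤ x → 0 ≤ y →
      (survival F m y).toReal / (survival F (n + m) x).toReal ≤ C * (renewalFn F y).toReal := by
  obtain ⟨C, hC1, hC⟩ := hF.spitzerSeq.exists_partialSum_le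
  refine ⟨C * (C * (q + 1)), fun n m hnm x y hx hy => ?_⟩
  rw [div_le_iff₀ (toReal_survival_pos hF.measure_Ioi_ne_zero _ hx)]
  calc (survival F m y).toReal ≤ C * (renewalFn F y).toReal * (survival F m 0).toReal :=
        hF.spitzerSeq.conv_le (fun _ => ENNReal.toReal_nonneg)
          (hasSum_ladderMass hF.measure_Ioi_ne_zero hy) (fun n => toReal_survival_eq_sum n hy)
          (toReal_survival_antitone y) hC m
    _ ≤ C * (renewalFn F y).toReal * (C * (q + 1) * (survival F (n + m) x).toReal) := by
        gcongr
        exact (hF.spitzerSeq.apply_le_mul_apply_add hC hnm).trans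
          (mul_le_mul_of_nonneg_left (toReal_survival_mono (F := F) _ hx) (by positivity))
    _ = C * (C * (q + 1)) * (renewalFn F y).toReal * (survival F (n + m) x).toReal := by ring

lemma tendsto_survival_ratio (hF : SpitzerLaw F ρ) (k : ℕ) {x y : ℝ} (hx : 0 ≤ x)
    (hy : 0 ≤ y) :
    Tendsto (fun j => (survival F j y).toReal / (survival F (k + j) x).toReal) atTop
      (𝓝 ((renewalFn F y).toReal / (renewalFn F x).toReal)) := by
  have renewal_ne_zero : (renewalFn F x).toReal ≠ 0 :=
    (zero_lt_one.trans_le (one_le_toReal_renewalFn hF.measure_Ioi_ne_zero hx)).ne'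
  have tendsto_shift := (hF.tendsto_survival_div hx).comp (tendsto_add_atTop_nat k)
  have tendsto_quot := ((hF.tendsto_survival_div hy).div tendsto_shift renewal_ne_zero).div
    (hF.spitzerSeq.tendsto_add_div k) one_ne_zero
  rw [div_one] at tendsto_quot
  refine tendsto_quot.congr fun j => ?_
  have := (hF.spitzerSeq.apply_pos j).ne'
  have := (hF.spitzerSeq.apply_pos (k + j)).ne'
  simp only [Pi.div_apply, Function.comp_apply, add_comm j k]
  field_simp

lemma exists_eventually_survival_le (hF : SpitzerLaw F ρ) {x : ℝ} (hx : 0 ≤ x) {c : ℝ}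
    (hc : 1 < c) : ∃ q : ℕ, 0 < q ∧ ∀ᶠ n in atTop,
      (survival F n x).toReal ≤ c * (survival F (n + n / q) x).toReal :=
  hF.spitzerSeq.exists_eventually_le_mul_add_div (hF.tendsto_survival_div hx)
    (zero_lt_one.trans_le (one_le_toReal_renewalFn hF.measure_Ioi_ne_zero hx)) hc

end SpitzerLaw

end SpitzerCondition

/-! ### Walks driven by i.i.d. inputs -/

noncomputable section Steps

open Set

variable {E : Type*}

/-- The first `n` terms of a sequence, continued by a constant. A function `f` of a sequence depends
only on the first `n` terms if `f (trunc c n b) = f b` for all `b`. -/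
def trunc (c : E) (n : ℕ) (b : ℕ → E) : ℕ → E := fun k => if k < n then b k else c

lemma trunc_of_lt (c : E) {k n : ℕ} (hk : k < n) (b : ℕ → E) : trunc c n b k = b k := if_pos hk

lemma trunc_of_le (c : E) {k n : ℕ} (hk : n ≤ k) (b : ℕ → E) : trunc c n b k = c := if_neg hk.not_gt

lemma trunc_trunc (c : E) (n : ℕ) (b : ℕ → E) : trunc c n (trunc c n b) = trunc c n b := by
  funext k
  by_cases hk : k < n <;> simp [trunc, hk]

lemma update_trunc (c : E) (n : ℕ) (b : ℕ → E) :
    Function.update (trunc c n b) n (b n) = trunc c (n + 1) b := by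
  funext k
  rcases lt_trichotomy k n with hk | rfl | hk
  · rw [Function.update_of_ne hk.ne, trunc_of_lt c hk, trunc_of_lt c (hk.trans n.lt_succ_self)]
  · rw [Function.update_self, trunc_of_lt c k.lt_succ_self]
  · rw [Function.update_of_ne hk.ne', trunc_of_le c hk.le, trunc_of_le c hk]

/-- The permutation of `ℕ` that reverses the first `n` indices. -/
def reversal (n : ℕ) : Equiv.Perm ℕ :=
  Function.Involutive.toPerm (fun k => if k < n then n - 1 - k else k) fun k => by
    by_cases hk : k < n
    · have : n - 1 - k < n := by omega
      simp only [hk, this, if_true]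
      omega
    · simp [hk]

lemma reversal_apply {n k : ℕ} (hk : k < n) : reversal n k = n - 1 - k :=
  if_pos hk

section Height

variable (ζ : E → ℝ)

/-- The position at time `n` of the walk with increments `ζ (b k)`, started at `x`. -/
def height (x : ℝ) (b : ℕ → E) (n : ℕ) : ℝ := x + ∑ k ∈ Finset.range n, ζ (b k)

/-- The event that the walk started at `x` stays nonnegative up to time `n`. -/
def staySet (x : ℝ) (n : ℕ) : Set (ℕ → E) := {b | ∀ k ≤ n, 0 ≤ height ζ x b k}

/-- The event that the walk started at `0` is negative at the times `1, …, n`. -/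
def belowSet (n : ℕ) : Set (ℕ → E) := {b | ∀ k < n, height ζ 0 b (k + 1) < 0}

variable {ζ}

@[simp] lemma height_zero (x : ℝ) (b : ℕ → E) : height ζ x b 0 = x := by simp [height]

lemma height_succ (x : ℝ) (b : ℕ → E) (n : ℕ) :
    height ζ x b (n + 1) = height ζ x b n + ζ (b n) := by
  simp [height, Finset.sum_range_succ, add_assoc]

lemma height_trunc (c : E) (x : ℝ) {n k : ℕ} (hk : k ≤ n) (b : ℕ → E) :
    height ζ x (trunc c n b) k = height ζ x b k := by
  unfold height
  congr 1
  exact Finset.sum_congr rfl fun j hj => by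
    rw [trunc_of_lt c ((Finset.mem_range.1 hj).trans_le hk)]

lemma height_reversal (b : ℕ → E) {n k : ℕ} (hk : k ≤ n) :
    height ζ 0 (fun j => b (reversal n j)) k = height ζ 0 b n - height ζ 0 b (n - k) := by
  induction k with
  | zero => simp
  | succ k ih =>
    have height_sub : height ζ 0 b (n - k) = height ζ 0 b (n - (k + 1)) + ζ (b (n - 1 - k)) := by
      rw [← Nat.sub_add_eq n 1 k, add_comm 1 k, ← height_succ]
      congr 1
      omega
    rw [height_succ, ih (by omega), reversal_apply (by omega), height_sub]
    ring

/-- The duality between strictly descending ladder times and walks that stay negative. -/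
lemma reversal_mem_belowSet {n : ℕ} {b : ℕ → E} :
    (fun k => b (reversal n k)) ∈ belowSet ζ n ↔ ∀ k < n, height ζ 0 b n < height ζ 0 b k := by
  have height_lt_zero {k : ℕ} (hk : k < n) : height ζ 0 (fun j => b (reversal n j)) (k + 1) < 0 ↔
      height ζ 0 b n < height ζ 0 b (n - (k + 1)) := by rw [height_reversal b hk, sub_neg]
  refine ⟨fun h k hk => ?_, fun h k hk => (height_lt_zero hk).2 (h _ (by omega))⟩
  have := (height_lt_zero (k := n - (k + 1)) (by omega)).1 (h _ (by omega))
  rwa [show n - (n - (k + 1) + 1) = k by omega] at this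

lemma trunc_mem_staySet (c : E) (x : ℝ) (n : ℕ) (b : ℕ → E) :
    trunc c n b ∈ staySet ζ x n ↔ b ∈ staySet ζ x n :=
  forall₂_congr fun _ hk => by rw [height_trunc c x hk]

lemma trunc_mem_belowSet (c : E) (n : ℕ) (b : ℕ → E) :
    trunc c n b ∈ belowSet ζ n ↔ b ∈ belowSet ζ n :=
  forall₂_congr fun _ hk => by rw [height_trunc c 0 hk]

lemma indicator_staySet_succ (x : ℝ) (n : ℕ) (g : ℝ → ℝ≥0∞) (b : ℕ → E) :
    (staySet ζ x (n + 1)).indicator (fun b => g (height ζ x b (n + 1))) b =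
      (staySet ζ x n).indicator 1 b * (Ici 0).indicator g (height ζ x b n + ζ (b n)) := by
  have mem_succ : b ∈ staySet ζ x (n + 1) ↔ b ∈ staySet ζ x n ∧ height ζ x b (n + 1) ∈ Ici 0 :=
    ⟨fun h => ⟨fun k hk => h k (hk.trans n.le_succ), h _ le_rfl⟩,
      fun h k hk => (Nat.le_succ_iff_eq_or_le.1 hk).elim (fun e => e ▸ h.2) (h.1 k)⟩
  rw [← height_succ]
  by_cases h₁ : b ∈ staySet ζ x n <;> by_cases h₂ : height ζ x b (n + 1) ∈ Ici 0 <;>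
    simp [indicator, mem_succ, h₁, h₂, -mem_Ici]

lemma indicator_belowSet_succ (n : ℕ) (g : ℝ → ℝ≥0∞) (b : ℕ → E) :
    (belowSet ζ (n + 1)).indicator (fun b => g (height ζ 0 b (n + 1))) b =
      (belowSet ζ n).indicator 1 b * (Iio 0).indicator g (height ζ 0 b n + ζ (b n)) := by
  have mem_succ : b ∈ belowSet ζ (n + 1) ↔ b ∈ belowSet ζ n ∧ height ζ 0 b (n + 1) ∈ Iio 0 :=
    Nat.forall_lt_succ_right
  rw [← height_succ]
  by_cases h₁ : b ∈ belowSet ζ n <;> by_cases h₂ : height ζ 0 b (n + 1) ∈ Iio 0 <;>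
    simp [indicator, mem_succ, h₁, h₂, -mem_Iio]

end Height

variable [MeasurableSpace E] {ζ : E → ℝ}

lemma measurable_trunc (c : E) (n : ℕ) : Measurable (trunc c n) := by
  refine measurable_pi_lambda _ fun k => ?_
  by_cases hk : k < n
  · simpa [trunc, hk] using measurable_pi_apply k
  · simp [trunc, hk]

lemma measurable_height (hζ : Measurable ζ) (x : ℝ) (n : ℕ) :
    Measurable fun b => height ζ x b n :=
  measurable_const.add (Finset.measurable_sum _ fun k _ => hζ.comp (measurable_pi_apply k))

lemma measurableSet_staySet (hζ : Measurable ζ) (x : ℝ) (n : ℕ) :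
    MeasurableSet (staySet ζ x n) := by
  simp only [staySet, ofPred_forall]
  exact MeasurableSet.iInter fun k => MeasurableSet.iInter fun _ =>
    measurable_height hζ x k measurableSet_Ici

lemma measurableSet_belowSet (hζ : Measurable ζ) (n : ℕ) : MeasurableSet (belowSet ζ n) := by
  simp only [belowSet, ofPred_forall]
  exact MeasurableSet.iInter fun k => MeasurableSet.iInter fun _ =>
    measurable_height hζ 0 (k + 1) measurableSet_Iio

lemma lintegral_map_indicator {ν : Measure E} (hζ : Measurable ζ) {B : Set ℝ}
    (hB : MeasurableSet B) {g : ℝ → ℝ≥0∞} (hg : Measurable g) (s : ℝ) :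
    ∫⁻ y, B.indicator g (s + y) ∂(ν.map ζ) = ∫⁻ e, B.indicator g (s + ζ e) ∂ν :=
  lintegral_map ((hg.indicator hB).comp (measurable_const_add s)) hζ

/-- The law of an i.i.d. sequence of inputs with law `ν`. -/
abbrev iidLaw (ν : Measure E) : Measure (ℕ → E) :=
  Measure.infinitePi fun _ => ν

variable (ν : Measure E) [IsProbabilityMeasure ν]

lemma iidLaw_map_perm (π : Equiv.Perm ℕ) :
    (iidLaw ν).map (fun b k => b (π k)) = iidLaw ν := by
  have map_piCongrLeft := Measure.infinitePi_map_piCongrLeft (fun _ : ℕ => ν) π.symm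
  convert! map_piCongrLeft using 2
  funext b k
  rw [MeasurableEquiv.coe_piCongrLeft]
  simpa using (Equiv.piCongrLeft_apply_apply (fun _ : ℕ => E) π.symm b (π k)).symm

lemma indepFun_trunc_eval (c : E) (n : ℕ) :
    IndepFun (trunc c n) (fun b : ℕ → E => b n) (iidLaw ν) := by
  have indep_eval : iIndepFun (fun (i : ℕ) (b : ℕ → E) => b i) (iidLaw ν) :=
    iIndepFun_infinitePi (P := fun _ : ℕ => ν) (X := fun _ e => e) fun _ => measurable_id
  let extend : (Finset.range n → E) → ℕ → E := fun d k =>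
    if hk : k < n then d ⟨k, Finset.mem_range.2 hk⟩ else c
  have measurable_extend : Measurable extend := by
    refine measurable_pi_lambda _ fun k => ?_
    by_cases hk : k < n
    · simpa [extend, hk] using measurable_pi_apply _
    · simp [extend, hk]
  exact (indep_eval.indepFun_finset (Finset.range n) {n} (by simp) measurable_pi_apply).comp
    (φ := extend) (ψ := fun d => d ⟨n, Finset.mem_singleton_self n⟩) measurable_extend
    (measurable_pi_apply (X := fun _ => E) _)

lemma iidLaw_map_trunc_prodMk_eval (c : E) (n : ℕ) :
    (iidLaw ν).map (fun b => (trunc c n b, b n)) = ((iidLaw ν).map (trunc c n)).prod ν := by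
  rw [(indepFun_iff_map_prod_eq_prod_map_map (measurable_trunc c n).aemeasurable
    (measurable_pi_apply n).aemeasurable).1 (indepFun_trunc_eval ν c n),
    Measure.infinitePi_map_eval]

lemma lintegral_iidLaw_step (c : E) (n : ℕ) {f : (ℕ → E) → E → ℝ≥0∞}
    (hf : Measurable (Function.uncurry f)) (hfc : ∀ b e, f (trunc c n b) e = f b e) :
    ∫⁻ b, f b (b n) ∂iidLaw ν = ∫⁻ b, ∫⁻ e, f b e ∂ν ∂iidLaw ν := by
  have hc := measurable_trunc c n
  calc ∫⁻ b, f b (b n) ∂iidLaw ν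
      = ∫⁻ b, Function.uncurry f (trunc c n b, b n) ∂iidLaw ν :=
        lintegral_congr fun b => (hfc b _).symm
    _ = ∫⁻ p, Function.uncurry f p ∂((iidLaw ν).map fun b => (trunc c n b, b n)) :=
        (lintegral_map hf (hc.prodMk (measurable_pi_apply n))).symm
    _ = ∫⁻ b, ∫⁻ e, f b e ∂ν ∂((iidLaw ν).map (trunc c n)) := by
        rw [iidLaw_map_trunc_prodMk_eval, lintegral_prod _ hf.aemeasurable]
        rfl
    _ = ∫⁻ b, ∫⁻ e, f (trunc c n b) e ∂ν ∂iidLaw ν := lintegral_map hf.lintegral_prod_right' hc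
    _ = ∫⁻ b, ∫⁻ e, f b e ∂ν ∂iidLaw ν := by simp only [hfc]

variable {ν}

lemma lintegral_iidLaw_mul_indicator (hζ : Measurable ζ) (c : E) (x : ℝ) (n : ℕ)
    {Z : (ℕ → E) → ℝ≥0∞} (hZ : Measurable Z) (hZc : ∀ b, Z (trunc c n b) = Z b) {B : Set ℝ}
    (hB : MeasurableSet B) {g : ℝ → ℝ≥0∞} (hg : Measurable g) :
    ∫⁻ b, Z b * B.indicator g (height ζ x b n + ζ (b n)) ∂iidLaw ν =
      ∫⁻ b, Z b * ∫⁻ y, B.indicator g (height ζ x b n + y) ∂(ν.map ζ) ∂iidLaw ν := by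
  have hgB := hg.indicator hB
  rw [lintegral_iidLaw_step ν c n
    (f := fun b e => Z b * B.indicator g (height ζ x b n + ζ e)) ?_ ?_]
  · refine lintegral_congr fun b => ?_
    rw [lintegral_map_indicator hζ hB hg,
      lintegral_const_mul _ (by fun_prop)]
  · exact (hZ.comp measurable_fst).mul (hgB.comp
      (((measurable_height hζ x n).comp measurable_fst).add (hζ.comp measurable_snd)))
  · intro b e
    rw [hZc, height_trunc c x le_rfl]

variable {F : Measure ℝ} [IsProbabilityMeasure F]

lemma lintegral_indicator_belowSet (hζ : Measurable ζ) (hF : ν.map ζ = F) (n : ℕ) {g : ℝ → ℝ≥0∞}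
    (hg : Measurable g) :
    ∫⁻ b, (belowSet ζ n).indicator (fun b => g (height ζ 0 b n)) b ∂iidLaw ν =
      ∫⁻ y, g y ∂(belowLaw F n).toMeasure := by
  obtain ⟨c⟩ : Nonempty E := ν.nonempty_of_neZero
  induction n generalizing g with
  | zero => simp [belowSet, belowLaw, killedPow, lintegral_dirac' _ hg]
  | succ n ih =>
    have hgI := hg.indicator (measurableSet_Iio (a := (0 : ℝ)))
    calc ∫⁻ b, (belowSet ζ (n + 1)).indicator (fun b => g (height ζ 0 b (n + 1))) b ∂iidLaw ν
        = ∫⁻ b, (belowSet ζ n).indicator 1 b *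
            (Iio 0).indicator g (height ζ 0 b n + ζ (b n)) ∂iidLaw ν :=
          lintegral_congr (indicator_belowSet_succ n g)
      _ = ∫⁻ b, (belowSet ζ n).indicator 1 b *
            ∫⁻ y, (Iio 0).indicator g (height ζ 0 b n + y) ∂F ∂iidLaw ν := by
          rw [lintegral_iidLaw_mul_indicator hζ c 0 n
            (measurable_one.indicator (measurableSet_belowSet hζ n))
            (fun b => indicator_eq_indicator (trunc_mem_belowSet c n b) rfl)
            measurableSet_Iio hg, hF]
      _ = ∫⁻ b, (belowSet ζ n).indicator
            (fun b => ∫⁻ y, (Iio 0).indicator g (height ζ 0 b n + y) ∂F) b ∂iidLaw ν := by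
          simp only [indicator, Pi.one_apply, ite_mul, one_mul, zero_mul]
      _ = ∫⁻ z, ∫⁻ y, (Iio 0).indicator g (z + y) ∂F ∂(belowLaw F n).toMeasure :=
          ih (Measurable.lintegral_prod_right'
            (f := fun p : ℝ × ℝ => (Iio 0).indicator g (p.1 + p.2)) (hgI.comp measurable_add))
      _ = ∫⁻ y, g y ∂(belowLaw F (n + 1)).toMeasure := by
          rw [← Measure.lintegral_conv hgI, lintegral_indicator measurableSet_Iio]
          rfl

lemma iidLaw_ladder (hζ : Measurable ζ) (hF : ν.map ζ = F) (n : ℕ) (y : ℝ) :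
    iidLaw ν {b | -y ≤ height ζ 0 b n ∧ ∀ k < n, height ζ 0 b n < height ζ 0 b k} =
      ladderMass F n y := by
  have measurableSet_le_height : MeasurableSet {b : ℕ → E | -y ≤ height ζ 0 b n} :=
    measurableSet_le measurable_const (measurable_height hζ 0 n)
  have hB := measurableSet_belowSet hζ n
  have ladder_eq_preimage :
      {b : ℕ → E | -y ≤ height ζ 0 b n ∧ ∀ k < n, height ζ 0 b n < height ζ 0 b k} =
        (fun (b : ℕ → E) k => b (reversal n k)) ⁻¹'
          (belowSet ζ n ∩ {b | -y ≤ height ζ 0 b n}) := by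
    ext b
    simp only [preimage_inter, mem_inter_iff, mem_preimage, reversal_mem_belowSet, mem_ofPred_eq,
      height_reversal b le_rfl, Nat.sub_self, height_zero, sub_zero, and_comm]
  rw [ladder_eq_preimage, ← Measure.map_apply
    (measurable_pi_lambda _ fun k => measurable_pi_apply _) (hB.inter measurableSet_le_height),
    iidLaw_map_perm, ladderMass, ← lintegral_indicator_one measurableSet_Ici,
    ← lintegral_indicator_belowSet hζ hF n (measurable_one.indicator measurableSet_Ici),
    ← lintegral_indicator_one (hB.inter measurableSet_le_height), inter_indicator_one]
  refine lintegral_congr fun b => ?_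
  simp only [indicator, Pi.mul_apply, mem_ofPred_eq, mem_Ici, Pi.one_apply, ite_mul, one_mul,
    zero_mul]

end Steps

/-! ### The spine -/

noncomputable section StepLaw

/-- The displacement of the spine in one step; the value at a non-existing child is `0`. -/
def stepHeight (e : Offspring × ℕ) : ℝ := (e.1 e.2).untopD 0

/-- The law of the displacement of the spine in one step. -/
def stepLaw (Θ : Measure Offspring) : Measure ℝ := (spineStep Θ).map stepHeight

lemma measurable_apply_prod : Measurable fun e : Offspring × ℕ => e.1 e.2 :=
  measurable_from_prod_countable_left fun i => measurable_pi_apply i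

lemma measurable_stepHeight : Measurable stepHeight :=
  (WithTop.measurable_untopD 0).comp measurable_apply_prod

lemma measurable_ofReal_expNeg :
    Measurable fun p : Offspring × ℕ => ENNReal.ofReal (expNeg (p.1 p.2)) :=
  (measurable_expNeg.comp measurable_apply_prod).ennreal_ofReal

lemma measurable_ofReal_expNeg_div_weight :
    Measurable fun p : Offspring × ℕ => ENNReal.ofReal (expNeg (p.1 p.2)) / weight p.1 :=
  measurable_ofReal_expNeg.div (measurable_weight.comp measurable_fst)

lemma expNeg_nonneg (y : WithTop ℝ) : 0 ≤ expNeg y := by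
  unfold expNeg
  split_ifs <;> positivity

variable {Θ : Measure Offspring}

instance [IsProbabilityMeasure (spineStep Θ)] : IsProbabilityMeasure (stepLaw Θ) :=
  Measure.isProbabilityMeasure_map measurable_stepHeight.aemeasurable

lemma ae_spineStep_ne_top : ∀ᵐ e ∂spineStep Θ, e.1 e.2 ≠ ⊤ := by
  rw [spineStep, ae_withDensity_iff measurable_ofReal_expNeg_div_weight]
  refine Eventually.of_forall fun p density_ne_zero apply_eq_top => density_ne_zero ?_
  simp [expNeg, apply_eq_top]

namespace BoundaryCase

lemma spineStep_eq (h : BoundaryCase Θ) :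
    spineStep Θ = (Θ.prod Measure.count).withDensity
      fun p => ENNReal.ofReal (expNeg (p.1 p.2)) := by
  have measurable_weight_fst : Measurable fun p : Offspring × ℕ => weight p.1 :=
    measurable_weight.comp measurable_fst
  have weight_lt_top : ∀ᵐ v ∂Θ, weight v < ∞ :=
    ae_lt_top measurable_weight (by rw [h.normalized]; exact ENNReal.one_ne_top)
  rw [spineStep, sizeBiased, prod_withDensity_left measurable_weight,
    ← withDensity_mul _ measurable_weight_fst measurable_ofReal_expNeg_div_weight]
  refine withDensity_congr_ae ?_
  filter_upwards [Measure.quasiMeasurePreserving_fst.ae weight_lt_top] with p hp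
  refine ENNReal.mul_div_cancel' (fun weight_eq_zero => ?_) fun weight_eq_top =>
    absurd weight_eq_top hp.ne
  exact ENNReal.tsum_eq_zero.1 weight_eq_zero p.2

lemma lintegral_spineStep (h : BoundaryCase Θ) {f : Offspring × ℕ → ℝ≥0∞} (hf : Measurable f) :
    ∫⁻ e, f e ∂spineStep Θ = ∫⁻ v, ∑' i, ENNReal.ofReal (expNeg (v i)) * f (v, i) ∂Θ := by
  rw [h.spineStep_eq, lintegral_withDensity_eq_lintegral_mul _ measurable_ofReal_expNeg hf,
    lintegral_prod _ (measurable_ofReal_expNeg.mul hf).aemeasurable]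
  simp [lintegral_count]

lemma integral_spineStep [SFinite Θ] (h : BoundaryCase Θ) {f : Offspring × ℕ → ℝ}
    (hf : Integrable f (spineStep Θ)) :
    ∫ e, f e ∂spineStep Θ = ∫ v, ∑' i, f (v, i) * expNeg (v i) ∂Θ := by
  have density_lt_top : ∀ᵐ p ∂Θ.prod (Measure.count : Measure ℕ),
      ENNReal.ofReal (expNeg (p.1 p.2)) < ∞ := ae_of_all _ fun _ => ENNReal.ofReal_lt_top
  rw [h.spineStep_eq, integrable_withDensity_iff_integrable_smul' measurable_ofReal_expNeg
    density_lt_top] at hf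
  rw [h.spineStep_eq, integral_withDensity_eq_integral_toReal_smul measurable_ofReal_expNeg
    density_lt_top, integral_prod _ hf]
  refine integral_congr_ae ?_
  filter_upwards [hf.prod_right_ae] with v hv
  rw [integral_countable hv]
  refine tsum_congr fun i => ?_
  simp [Measure.real, ENNReal.toReal_ofReal (expNeg_nonneg _), mul_comm]

lemma lintegral_sq_stepLaw (h : BoundaryCase Θ) :
    ∫⁻ y, ENNReal.ofReal (y ^ 2) ∂stepLaw Θ =
      ∫⁻ v, ∑' i, ENNReal.ofReal ((v i).untopD 0 ^ 2 * expNeg (v i)) ∂Θ := by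
  rw [stepLaw, lintegral_map (by fun_prop) measurable_stepHeight,
    h.lintegral_spineStep (measurable_stepHeight.pow_const 2).ennreal_ofReal]
  refine lintegral_congr fun v => tsum_congr fun i => ?_
  rw [stepHeight, mul_comm, ← ENNReal.ofReal_mul (sq_nonneg _)]

lemma integrable_sq_stepLaw (h : BoundaryCase Θ) :
    Integrable (fun y => y ^ 2) (stepLaw Θ) := by
  refine ⟨by fun_prop, ?_⟩
  rw [hasFiniteIntegral_iff_ofReal (ae_of_all _ sq_nonneg), h.lintegral_sq_stepLaw]
  exact h.variance_lt_top

lemma centeredLaw [SFinite Θ] [IsProbabilityMeasure (spineStep Θ)] (h : BoundaryCase Θ) :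
    CenteredLaw (stepLaw Θ) where
  integral_eq_zero := by
    have integrable_id : Integrable (fun y => y) (stepLaw Θ) :=
      ((memLp_two_iff_integrable_sq measurable_id.aestronglyMeasurable).2
        h.integrable_sq_stepLaw).integrable one_le_two
    have integrable_stepHeight : Integrable stepHeight (spineStep Θ) :=
      (integrable_map_measure measurable_id.aestronglyMeasurable
        measurable_stepHeight.aemeasurable).1 integrable_id
    rw [stepLaw, integral_map (f := fun y => y) measurable_stepHeight.aemeasurable
      measurable_id.aestronglyMeasurable, h.integral_spineStep integrable_stepHeight]
    exact h.centered
  integrable_sq := h.integrable_sq_stepLaw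
  integral_sq_pos := by
    rw [integral_eq_lintegral_of_nonneg_ae (ae_of_all _ sq_nonneg) (by fun_prop),
      h.lintegral_sq_stepLaw]
    exact ENNReal.toReal_pos h.variance_pos.ne' h.variance_lt_top.ne

end BoundaryCase

end StepLaw

noncomputable section Path

open Set

lemma measurable_of_canonicalFiltration {β : Type*} [MeasurableSpace β] {n : ℕ} {Z : Path → β}
    (hZ : Measurable[canonicalFiltration n] Z) : Measurable Z :=
  hZ.mono (canonicalFiltration.le n) le_rfl

lemma measurable_canonicalFiltration_of_le {β : Type*} [MeasurableSpace β] {k n : ℕ} (hk : k ≤ n)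
    {Z : Path → β} (hZ : Measurable[canonicalFiltration k] Z) :
    Measurable[canonicalFiltration n] Z :=
  hZ.mono (canonicalFiltration.mono hk) le_rfl

lemma measurable_canonicalFiltration_apply_vertex {n : ℕ} {u : Vertex} (hu : u.length ≤ n) :
    Measurable[canonicalFiltration n] fun ω : Path => ω.1 u :=
  Measurable.mono (comap_measurable _) (le_sup_of_le_left (le_iSup₂_of_le u hu le_rfl)) le_rfl

lemma measurable_canonicalFiltration_spine {k n : ℕ} (hk : k ≤ n) :
    Measurable[canonicalFiltration n] fun ω : Path => ω.2 k :=
  Measurable.mono (comap_measurable _) (le_sup_of_le_right (le_iSup₂_of_le k hk le_rfl)) le_rfl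

lemma measurable_spinePos (n : ℕ) : Measurable (spinePos n) :=
  (measurable_from_prod_countable_left
    (f := fun p : (Vertex → WithTop ℝ) × Vertex => p.1 p.2) measurable_pi_apply).comp
      (measurable_fst.prodMk ((measurable_pi_apply n).comp measurable_snd))

/-- The real position of the spine. Paths whose spine is not a line of descent, a null event, are
given the value `0`, so that this only depends on the first `n` generations. -/
def spineHeight (n : ℕ) (ω : Path) : ℝ :=
  if (ω.2 n).length = n then (ω.1 (ω.2 n)).untopD 0 else 0

/-- The event that the spine stays nonnegative up to time `n`, in terms of `spineHeight`. Unlike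
`stayNonneg n` it belongs to the `n`-th σ-algebra of the canonical filtration. -/
def stayHeight (n : ℕ) : Set Path := {ω | ∀ k ≤ n, 0 ≤ spineHeight k ω}

lemma measurable_spineHeight (n : ℕ) : Measurable[canonicalFiltration n] (spineHeight n) := by
  intro B hB
  have preimage_eq_iUnion : spineHeight n ⁻¹' B = ⋃ u : Vertex, (fun ω : Path => ω.2 n) ⁻¹' {u} ∩
      {ω | (if u.length = n then (ω.1 u).untopD 0 else 0) ∈ B} := by
    ext ω
    simp only [mem_preimage, mem_iUnion, mem_inter_iff, mem_singleton_iff, mem_ofPred_eq]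
    exact ⟨fun h => ⟨ω.2 n, rfl, h⟩, by rintro ⟨u, rfl, h⟩; exact h⟩
  rw [preimage_eq_iUnion]
  refine MeasurableSet.iUnion fun u =>
    (measurable_canonicalFiltration_spine le_rfl (measurableSet_singleton u)).inter ?_
  by_cases hu : u.length = n
  · simp only [hu, if_true]
    exact (WithTop.measurable_untopD 0).comp
      (measurable_canonicalFiltration_apply_vertex hu.le) hB
  · simp only [hu, if_false]
    exact MeasurableSet.const _

lemma measurableSet_stayHeight (n : ℕ) : MeasurableSet[canonicalFiltration n] (stayHeight n) := by
  simp only [stayHeight, ofPred_forall]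
  exact MeasurableSet.iInter fun k => MeasurableSet.iInter fun hk =>
    measurable_canonicalFiltration_of_le hk (measurable_spineHeight k) measurableSet_Ici

/-- The canonical path built from the inputs. -/
def pathOf (x : ℝ) (a : Input) : Path := (positionOf x a, spineOf a)

lemma measurable_pathOf (x : ℝ) : Measurable (pathOf x) :=
  (measurable_pi_lambda _ (measurable_positionOf x)).prodMk
    (measurable_pi_lambda _ measurable_spineOf)

/-- The inputs with the spine steps after generation `n` erased. -/
def truncInput (n : ℕ) (a : Input) : Input := (a.1, trunc 0 n a.2)

lemma length_spineOf (a : Input) (n : ℕ) : (spineOf a n).length = n := by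
  induction n with
  | zero => rfl
  | succ n ih => rw [spineOf, List.length_cons, ih]

lemma spineOf_truncInput (a : Input) {k n : ℕ} (hk : k ≤ n) :
    spineOf (truncInput n a) k = spineOf a k := by
  induction k with
  | zero => rfl
  | succ k ih =>
    rw [spineOf, spineOf, ih (Nat.le_of_succ_le hk)]
    simp only [truncInput, trunc_of_lt _ (Nat.lt_of_succ_le hk)]

lemma positionOf_truncInput (x : ℝ) (a : Input) {n : ℕ} {u : Vertex} (hu : u.length ≤ n) :
    positionOf x (truncInput n a) u = positionOf x a u := by
  induction u with
  | nil => rfl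
  | cons i u ih =>
    rw [List.length_cons] at hu
    rw [positionOf, positionOf, ih (Nat.le_of_succ_le hu),
      spineOf_truncInput a (Nat.le_of_succ_le hu)]
    simp only [truncInput, trunc_of_lt _ (Nat.lt_of_succ_le hu)]

lemma pathOf_truncInput_mem_iff (x : ℝ) {n : ℕ} {A : Set Path}
    (hA : MeasurableSet[canonicalFiltration n] A) (a : Input) :
    pathOf x (truncInput n a) ∈ A ↔ pathOf x a ∈ A := by
  let invariantSets : MeasurableSpace Path :=
    { MeasurableSet' := fun A => pathOf x (truncInput n a) ∈ A ↔ pathOf x a ∈ A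
      measurableSet_empty := Iff.rfl
      measurableSet_compl := fun _ h => not_congr h
      measurableSet_iUnion := fun f h => by
        simp only [mem_iUnion]
        exact exists_congr h }
  have canonicalFiltration_le : canonicalFiltration n ≤ invariantSets := by
    refine sup_le (iSup₂_le fun u hu => ?_) (iSup₂_le fun k hk => ?_)
    · rintro _ ⟨B, _, rfl⟩
      change positionOf x (truncInput n a) u ∈ B ↔ positionOf x a u ∈ B
      rw [positionOf_truncInput x a hu]
    · rintro _ ⟨B, _, rfl⟩
      change spineOf (truncInput n a) k ∈ B ↔ spineOf a k ∈ B
      rw [spineOf_truncInput a hk]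
  exact canonicalFiltration_le A hA

lemma apply_pathOf_truncInput (x : ℝ) {n : ℕ} {Z : Path → ℝ≥0∞}
    (hZ : Measurable[canonicalFiltration n] Z) (a : Input) :
    Z (pathOf x (truncInput n a)) = Z (pathOf x a) :=
  (pathOf_truncInput_mem_iff x (hZ (measurableSet_singleton (Z (pathOf x a)))) a).2 rfl

lemma spinePos_pathOf (x : ℝ) {a : Input} (ha : ∀ k, (a.2 k).1 (a.2 k).2 ≠ ⊤) (n : ℕ) :
    spinePos n (pathOf x a) = ((height stepHeight x a.2 n : ℝ) : WithTop ℝ) := by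
  induction n with
  | zero => simp [spinePos, pathOf, spineOf, positionOf]
  | succ n ih =>
    change positionOf x a (spineOf a n) = _ at ih
    change positionOf x a (spineOf a (n + 1)) = _
    obtain ⟨y, hy⟩ := WithTop.ne_top_iff_exists.1 (ha n)
    rw [spineOf, positionOf, length_spineOf, if_pos rfl, ih, height_succ, WithTop.coe_add,
      stepHeight, ← hy, WithTop.untopD_coe]

lemma spineHeight_pathOf (x : ℝ) {a : Input} (ha : ∀ k, (a.2 k).1 (a.2 k).2 ≠ ⊤) (n : ℕ) :
    spineHeight n (pathOf x a) = height stepHeight x a.2 n := by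
  have untopD_spinePos := congrArg (WithTop.untopD 0) (spinePos_pathOf x ha n)
  exact (if_pos (length_spineOf a n)).trans untopD_spinePos

end Path

noncomputable section SpineLaw

open Set

variable {Θ : Measure Offspring} [IsProbabilityMeasure (spineStep Θ)]

lemma ae_iidLaw_spineStep_ne_top :
    ∀ᵐ b ∂iidLaw (spineStep Θ), ∀ k, (b k).1 (b k).2 ≠ ⊤ :=
  ae_all_iff.2 fun k => (measurePreserving_eval_infinitePi (fun _ : ℕ => spineStep Θ)
    k).quasiMeasurePreserving.ae ae_spineStep_ne_top

lemma lintegral_starLaw (x : ℝ) {f : Path → ℝ≥0∞} (hf : Measurable f) :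
    ∫⁻ ω, f ω ∂starLaw Θ x = ∫⁻ a, ∫⁻ b, f (pathOf x (a, b)) ∂iidLaw (spineStep Θ)
      ∂(Measure.infinitePi fun _ : Vertex => Θ) := by
  rw [← lintegral_prod (fun a => f (pathOf x a)) (hf.comp (measurable_pathOf x)).aemeasurable]
  exact lintegral_map hf (measurable_pathOf x)

lemma ae_inputLaw_ne_top : ∀ᵐ a ∂inputLaw Θ, ∀ k, (a.2 k).1 (a.2 k).2 ≠ ⊤ :=
  Measure.quasiMeasurePreserving_snd.ae ae_iidLaw_spineStep_ne_top

lemma ae_spinePos_eq (x : ℝ) :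
    ∀ᵐ ω ∂starLaw Θ x, ∀ n, spinePos n ω = ((spineHeight n ω : ℝ) : WithTop ℝ) := by
  have measurableSet_eq :
      MeasurableSet {ω : Path | ∀ n, spinePos n ω = ((spineHeight n ω : ℝ) : WithTop ℝ)} := by
    simp only [ofPred_forall]
    exact MeasurableSet.iInter fun n => measurableSet_eq_fun (measurable_spinePos n)
      (WithTop.measurable_coe.comp (measurable_of_canonicalFiltration (measurable_spineHeight n)))
  refine (ae_map_iff (measurable_pathOf x).aemeasurable measurableSet_eq).2 ?_
  filter_upwards [ae_inputLaw_ne_top] with a ha n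
  rw [spineHeight_pathOf x ha, spinePos_pathOf x ha]

lemma ae_mem_stayNonneg_iff (x : ℝ) :
    ∀ᵐ ω ∂starLaw Θ x, ∀ n, ω ∈ stayNonneg n ↔ ω ∈ stayHeight n := by
  filter_upwards [ae_spinePos_eq x] with ω hω n
  exact forall₂_congr fun k _ => by rw [hω]; exact WithTop.coe_nonneg

lemma lintegral_starLaw_mul_indicator_stayHeight (x : ℝ) (n : ℕ) {Z : Path → ℝ≥0∞}
    (hZ : Measurable Z) {g : ℝ → ℝ≥0∞} (hg : Measurable g) :
    ∫⁻ ω, Z ω * (stayHeight n).indicator (fun ω => g (spineHeight n ω)) ω ∂starLaw Θ x =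
      ∫⁻ a, ∫⁻ b, Z (pathOf x (a, b)) *
        (staySet stepHeight x n).indicator (fun b => g (height stepHeight x b n)) b
          ∂iidLaw (spineStep Θ) ∂(Measure.infinitePi fun _ : Vertex => Θ) := by
  have measurable_stay : Measurable ((stayHeight n).indicator fun ω => g (spineHeight n ω)) :=
    (hg.comp (measurable_of_canonicalFiltration (measurable_spineHeight n))).indicator
      (canonicalFiltration.le n _ (measurableSet_stayHeight n))
  rw [lintegral_starLaw (f := fun ω => Z ω * _) x (hZ.mul measurable_stay)]
  refine lintegral_congr fun a => lintegral_congr_ae ?_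
  filter_upwards [ae_iidLaw_spineStep_ne_top] with b hb
  have mem_iff : pathOf x (a, b) ∈ stayHeight n ↔ b ∈ staySet stepHeight x n :=
    forall₂_congr fun k _ => by rw [spineHeight_pathOf x (a := (a, b)) hb]
  exact congrArg (_ * ·) (indicator_eq_indicator mem_iff (congrArg g (spineHeight_pathOf x hb n)))

lemma lintegral_starLaw_step (x : ℝ) (n : ℕ) {Z : Path → ℝ≥0∞}
    (hZ : Measurable[canonicalFiltration n] Z) {g : ℝ → ℝ≥0∞} (hg : Measurable g) :
    ∫⁻ ω, Z ω * (stayHeight (n + 1)).indicator (fun ω => g (spineHeight (n + 1) ω)) ω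
        ∂starLaw Θ x =
      ∫⁻ ω, Z ω * (stayHeight n).indicator (fun ω => walkOp (stepLaw Θ) g (spineHeight n ω)) ω
        ∂starLaw Θ x := by
  have measurable_Z := measurable_of_canonicalFiltration hZ
  rw [lintegral_starLaw_mul_indicator_stayHeight x (n + 1) measurable_Z hg,
    lintegral_starLaw_mul_indicator_stayHeight x n measurable_Z (measurable_walkOp hg)]
  refine lintegral_congr fun a => ?_
  let past : (ℕ → Offspring × ℕ) → ℝ≥0∞ := fun b =>
    Z (pathOf x (a, b)) * (staySet stepHeight x n).indicator 1 b
  have measurable_past : Measurable past :=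
    (measurable_Z.comp ((measurable_pathOf x).comp measurable_prodMk_left)).mul
      (measurable_one.indicator (measurableSet_staySet measurable_stepHeight x n))
  have past_trunc b : past (trunc 0 n b) = past b :=
    congrArg₂ (· * ·) (apply_pathOf_truncInput x hZ (a, b))
      (indicator_eq_indicator (trunc_mem_staySet 0 x n b) rfl)
  calc ∫⁻ b, Z (pathOf x (a, b)) * (staySet stepHeight x (n + 1)).indicator
          (fun b => g (height stepHeight x b (n + 1))) b ∂iidLaw (spineStep Θ)
      = ∫⁻ b, past b * (Ici 0).indicator g (height stepHeight x b n + stepHeight (b n))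
          ∂iidLaw (spineStep Θ) :=
        lintegral_congr fun b => by rw [indicator_staySet_succ, mul_assoc]
    _ = ∫⁻ b, past b * walkOp (stepLaw Θ) g (height stepHeight x b n) ∂iidLaw (spineStep Θ) :=
        lintegral_iidLaw_mul_indicator measurable_stepHeight 0 x n measurable_past past_trunc
          measurableSet_Ici hg
    _ = ∫⁻ b, Z (pathOf x (a, b)) * (staySet stepHeight x n).indicator
          (fun b => walkOp (stepLaw Θ) g (height stepHeight x b n)) b ∂iidLaw (spineStep Θ) :=
        lintegral_congr fun b => by
          simp only [past, indicator, Pi.one_apply, mul_assoc, ite_mul, one_mul, zero_mul]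

variable [IsProbabilityMeasure Θ]

instance : IsProbabilityMeasure (inputLaw Θ) := by
  unfold inputLaw
  infer_instance

instance (x : ℝ) : IsProbabilityMeasure (starLaw Θ x) :=
  Measure.isProbabilityMeasure_map (measurable_pathOf x).aemeasurable

lemma starLaw_spineHeight_ladder (n : ℕ) (y : ℝ) :
    starLaw Θ 0 {ω | -y ≤ spineHeight n ω ∧ ∀ k < n, spineHeight n ω < spineHeight k ω} =
      ladderMass (stepLaw Θ) n y := by
  have measurableSet_ladder {α : Type} [MeasurableSpace α] {S : ℕ → α → ℝ}
      (hS : ∀ k, Measurable (S k)) : MeasurableSet {a | -y ≤ S n a ∧ ∀ k < n, S n a < S k a} := by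
    simp only [ofPred_and, ofPred_forall]
    exact (measurableSet_le measurable_const (hS n)).inter
      (MeasurableSet.iInter fun k => MeasurableSet.iInter fun _ => measurableSet_lt (hS n) (hS k))
  rw [← iidLaw_ladder (F := stepLaw Θ) measurable_stepHeight rfl n y,
    show starLaw Θ 0 = (inputLaw Θ).map (pathOf 0) from rfl,
    Measure.map_apply (measurable_pathOf 0)
      (measurableSet_ladder fun k => measurable_of_canonicalFiltration (measurable_spineHeight k)),
    ← Measure.snd_prod (μ := Measure.infinitePi fun _ : Vertex => Θ) (ν := iidLaw (spineStep Θ)),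
    Measure.snd_apply (measurableSet_ladder (measurable_height measurable_stepHeight 0))]
  refine measure_congr ?_
  filter_upwards [ae_inputLaw_ne_top] with a ha
  refine propext (and_congr ?_ (forall₂_congr fun k _ => ?_))
  · rw [spineHeight_pathOf 0 ha]
  · rw [spineHeight_pathOf 0 ha, spineHeight_pathOf 0 ha]

lemma renewal_eq (y : ℝ) : renewal Θ y = renewalFn (stepLaw Θ) y := by
  refine tsum_congr fun n => ?_
  rw [← starLaw_spineHeight_ladder]
  refine measure_congr ?_
  filter_upwards [ae_spinePos_eq 0] with ω hω
  refine propext (and_congr ?_ (forall₂_congr fun k _ => ?_))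
  · rw [hω]
    exact WithTop.coe_le_coe
  · rw [hω, hω]
    exact WithTop.coe_lt_coe

end SpineLaw

/-! ### The Doob transform of the killed walk -/

noncomputable section DoobTransform

open Set

variable {E : Type*}

/-- The sequence of the terms `1, …, n` of a finite sequence, continued by a constant: it extracts
the first `n` steps from a trajectory whose term `0` is a dummy initial state. -/
def shiftExtend (c : E) (n : ℕ) (d : Finset.Iic n → E) : ℕ → E := fun k =>
  if h : k < n then d ⟨k + 1, Finset.mem_Iic.2 h⟩ else c

lemma shiftExtend_frestrictLe (c : E) (n : ℕ) (z : ℕ → E) :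
    shiftExtend c n (Preorder.frestrictLe n z) = trunc c n fun k => z (k + 1) := by
  funext k
  by_cases hk : k < n <;> simp [shiftExtend, trunc, hk]

variable [MeasurableSpace E] {ζ : E → ℝ}

lemma measurable_shiftExtend (c : E) (n : ℕ) : Measurable (shiftExtend c n) := by
  refine measurable_pi_lambda _ fun k => ?_
  by_cases hk : k < n
  · simpa only [shiftExtend, hk, dite_true] using measurable_pi_apply _
  · simp only [shiftExtend, hk, dite_false, measurable_const]

lemma measurable_lintegral_kernel_height (hζ : Measurable ζ) (κ : Kernel ℝ E) [IsMarkovKernel κ]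
    (x : ℝ) (n : ℕ) {f : (ℕ → E) → E → ℝ≥0∞} (hf : Measurable (Function.uncurry f)) :
    Measurable fun b => ∫⁻ e, f b e ∂κ (height ζ x b n) :=
  Measurable.lintegral_kernel_prod_right'
    (κ := κ.comap (fun b => height ζ x b n) (measurable_height hζ x n)) hf

lemma exists_measure_lintegral_step (hζ : Measurable ζ) (κ : Kernel ℝ E) [IsMarkovKernel κ] (x : ℝ)
    (c : E) :
    ∃ Q : Measure (ℕ → E), IsProbabilityMeasure Q ∧
      ∀ (n : ℕ) (f : (ℕ → E) → E → ℝ≥0∞), Measurable (Function.uncurry f) →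
        (∀ b e, f (trunc c n b) e = f b e) →
        ∫⁻ b, f b (b n) ∂Q = ∫⁻ b, ∫⁻ e, f b e ∂κ (height ζ x b n) ∂Q := by
  let pastKernel : (n : ℕ) → Kernel (Finset.Iic n → E) E := fun n =>
    κ.comap (fun d => height ζ x (shiftExtend c n d) n)
      ((measurable_height hζ x n).comp (measurable_shiftExtend c n))
  let T : Measure (ℕ → E) := Kernel.trajMeasure (X := fun _ => E) (Measure.dirac c) pastKernel
  have : IsProbabilityMeasure T := by infer_instance
  have measurable_shift : Measurable fun (z : ℕ → E) k => z (k + 1) := by fun_prop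
  refine ⟨T.map fun z k => z (k + 1),
    Measure.isProbabilityMeasure_map measurable_shift.aemeasurable, fun n f hf hfc => ?_⟩
  have measurable_past : Measurable fun z : ℕ → E => Preorder.frestrictLe (π := fun _ => E) n z :=
    Preorder.measurable_frestrictLe n
  have measurable_f_past :
      Measurable fun p : (Finset.Iic n → E) × E => f (shiftExtend c n p.1) p.2 :=
    hf.comp (((measurable_shiftExtend c n).comp measurable_fst).prodMk measurable_snd)
  have measurable_f_last : Measurable fun b : ℕ → E => f b (b n) :=
    hf.comp (measurable_id.prodMk (measurable_pi_apply n))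
  rw [lintegral_map measurable_f_last measurable_shift,
    lintegral_map (measurable_lintegral_kernel_height hζ κ x n hf) measurable_shift]
  calc ∫⁻ z, f (fun k => z (k + 1)) (z (n + 1)) ∂T
      = ∫⁻ z, f (shiftExtend c n (Preorder.frestrictLe n z)) (z (n + 1)) ∂T :=
        lintegral_congr fun z => by rw [shiftExtend_frestrictLe, hfc]
    _ = ∫⁻ p, f (shiftExtend c n p.1) p.2
          ∂(T.map fun z => (Preorder.frestrictLe (π := fun _ => E) n z, z (n + 1))) :=
        (lintegral_map measurable_f_past
          (measurable_past.prodMk (measurable_pi_apply (n + 1)))).symm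
    _ = ∫⁻ d, ∫⁻ e, f (shiftExtend c n d) e ∂pastKernel n d
          ∂(T.map (Preorder.frestrictLe (π := fun _ => E) n)) := by
        rw [← Kernel.map_frestrictLe_trajMeasure_compProd_eq_map_trajMeasure
          (X := fun _ => E) (μ₀ := Measure.dirac c) (κ := pastKernel) (a := n),
          Measure.lintegral_compProd measurable_f_past]
    _ = ∫⁻ z, ∫⁻ e, f (shiftExtend c n (Preorder.frestrictLe n z)) e
          ∂pastKernel n (Preorder.frestrictLe n z) ∂T :=
        lintegral_map (Measurable.lintegral_kernel_prod_right' measurable_f_past) measurable_past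
    _ = ∫⁻ z, ∫⁻ e, f (fun k => z (k + 1)) e ∂κ (height ζ x (fun k => z (k + 1)) n) ∂T :=
        lintegral_congr fun z => by
          simp only [pastKernel, Kernel.comap_apply, shiftExtend_frestrictLe, hfc,
            height_trunc c x le_rfl]

/-- Positive finite harmonic functions of the walk killed on leaving `[0, ∞)`. -/
structure IsHarmonic (F : Measure ℝ) (V : ℝ → ℝ≥0∞) : Prop where
  measurable : Measurable V
  ne_zero : ∀ s, 0 ≤ s → V s ≠ 0
  ne_top : ∀ s, 0 ≤ s → V s ≠ ∞
  walkOp_eq : ∀ s, 0 ≤ s → walkOp F V s = V s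

variable {ν : Measure E} [IsProbabilityMeasure ν] {V : ℝ → ℝ≥0∞}

/-- The law of a step from position `s`, transformed by a function `V` that is harmonic for the walk
killed on leaving `[0, ∞)`. -/
def doobKernel (ζ : E → ℝ) (ν : Measure E) [IsProbabilityMeasure ν] (V : ℝ → ℝ≥0∞) : Kernel ℝ E :=
  Kernel.piecewise (measurableSet_Ici : MeasurableSet (Ici (0 : ℝ)))
    (Kernel.withDensity (Kernel.const ℝ ν) fun s e => (Ici 0).indicator V (s + ζ e) / V s)
    (Kernel.const ℝ ν)

namespace IsHarmonic

lemma lintegral_doobKernel (hV : IsHarmonic (ν.map ζ) V) (hζ : Measurable ζ) {s : ℝ} (hs : 0 ≤ s)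
    {f : E → ℝ≥0∞} (hf : Measurable f) :
    (∫⁻ e, f e ∂doobKernel ζ ν V s) * V s = ∫⁻ e, f e * (Ici 0).indicator V (s + ζ e) ∂ν := by
  have measurable_indicator := hV.measurable.indicator (measurableSet_Ici (a := (0 : ℝ)))
  have measurable_density :
      Measurable (Function.uncurry fun s e => (Ici 0).indicator V (s + ζ e) / V s) :=
    (measurable_indicator.comp (measurable_fst.add (hζ.comp measurable_snd))).div
      (hV.measurable.comp measurable_fst)
  have measurable_density_apply : Measurable fun e => (Ici 0).indicator V (s + ζ e) / V s :=
    (measurable_indicator.comp (hζ.const_add s)).div_const _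
  rw [doobKernel, Kernel.piecewise_apply, if_pos (mem_Ici.2 hs),
    Kernel.withDensity_apply _ measurable_density, Kernel.const_apply,
    lintegral_withDensity_eq_lintegral_mul _ measurable_density_apply hf,
    ← lintegral_mul_const _ (measurable_density_apply.mul hf)]
  refine lintegral_congr fun e => ?_
  rw [Pi.mul_apply, mul_right_comm, ENNReal.div_mul_cancel (hV.ne_zero s hs) (hV.ne_top s hs),
    mul_comm]

lemma isMarkovKernel_doobKernel (hV : IsHarmonic (ν.map ζ) V) (hζ : Measurable ζ) :
    IsMarkovKernel (doobKernel ζ ν V) := by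
  refine ⟨fun s => ?_⟩
  by_cases hs : 0 ≤ s
  · refine ⟨(ENNReal.mul_left_inj (hV.ne_zero s hs) (hV.ne_top s hs)).1 ?_⟩
    rw [← lintegral_one, hV.lintegral_doobKernel hζ hs measurable_const]
    simp_rw [one_mul]
    rw [← lintegral_map_indicator hζ measurableSet_Ici hV.measurable]
    exact hV.walkOp_eq s hs
  · rw [doobKernel, Kernel.piecewise_apply, if_neg (by simpa only [mem_Ici]), Kernel.const_apply]
    infer_instance

/-- The value of the harmonic function at time `n` cancels against the normalization of the
kernel. -/
lemma lintegral_doobKernel_mul_indicator (hV : IsHarmonic (ν.map ζ) V) (hζ : Measurable ζ) (x : ℝ)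
    (c : E) (n : ℕ) {f : (ℕ → E) → E → ℝ≥0∞} (hf : Measurable (Function.uncurry f))
    (hfc : ∀ b e, f (trunc c n b) e = f b e) :
    ∫⁻ b, (∫⁻ e, f b e ∂doobKernel ζ ν V (height ζ x b n)) *
        (staySet ζ x n).indicator (fun b => V (height ζ x b n)) b ∂iidLaw ν =
      ∫⁻ b, f b (b n) *
        (staySet ζ x (n + 1)).indicator (fun b => V (height ζ x b (n + 1))) b ∂iidLaw ν := by
  let weightedStep : (ℕ → E) → E → ℝ≥0∞ := fun b e => (staySet ζ x n).indicator 1 b *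
    (f b e * (Ici 0).indicator V (height ζ x b n + ζ e))
  have measurable_weightedStep : Measurable (Function.uncurry weightedStep) :=
    ((measurable_one.indicator (measurableSet_staySet hζ x n)).comp measurable_fst).mul
      (hf.mul ((hV.measurable.indicator measurableSet_Ici).comp
        (((measurable_height hζ x n).comp measurable_fst).add (hζ.comp measurable_snd))))
  have weightedStep_trunc b e : weightedStep (trunc c n b) e = weightedStep b e :=
    congrArg₂ (· * ·) (indicator_eq_indicator (trunc_mem_staySet c x n b) rfl)
      (by rw [hfc, height_trunc c x le_rfl])
  calc ∫⁻ b, (∫⁻ e, f b e ∂doobKernel ζ ν V (height ζ x b n)) *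
          (staySet ζ x n).indicator (fun b => V (height ζ x b n)) b ∂iidLaw ν
      = ∫⁻ b, ∫⁻ e, weightedStep b e ∂ν ∂iidLaw ν := by
        refine lintegral_congr fun b => ?_
        by_cases hb : b ∈ staySet ζ x n
        · simp only [weightedStep, indicator_of_mem hb, Pi.one_apply, one_mul]
          exact hV.lintegral_doobKernel hζ (hb n le_rfl) hf.of_uncurry_left
        · simp only [weightedStep, indicator_of_notMem hb, mul_zero, zero_mul, lintegral_zero]
    _ = ∫⁻ b, weightedStep b (b n) ∂iidLaw ν :=
        (lintegral_iidLaw_step ν c n measurable_weightedStep weightedStep_trunc).symm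
    _ = _ := lintegral_congr fun b => by
        rw [indicator_staySet_succ, mul_left_comm]

lemma exists_measure_lintegral (hV : IsHarmonic (ν.map ζ) V) (hζ : Measurable ζ) {x : ℝ}
    (hx : 0 ≤ x) (c : E) :
    ∃ Q : Measure (ℕ → E), IsProbabilityMeasure Q ∧
      ∀ (n : ℕ) (f : (ℕ → E) → ℝ≥0∞), Measurable f → (∀ b, f (trunc c n b) = f b) →
        (∫⁻ b, f b ∂Q) * V x = ∫⁻ b, f b *
          (staySet ζ x n).indicator (fun b => V (height ζ x b n)) b ∂iidLaw ν := by
  have := hV.isMarkovKernel_doobKernel hζ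
  obtain ⟨Q, _, lintegral_step⟩ := exists_measure_lintegral_step hζ (doobKernel ζ ν V) x c
  refine ⟨Q, inferInstance, fun n => ?_⟩
  induction n with
  | zero =>
    intro f _ hfc
    have f_eq_const b : f b = f fun _ => c := (hfc b).symm
    have mem_staySet_zero (b : ℕ → E) : b ∈ staySet ζ x 0 := by simpa [staySet]
    simp only [f_eq_const, indicator_of_mem (mem_staySet_zero _),
      height_zero, lintegral_const, measure_univ, mul_one]
  | succ n ih =>
    intro f hf hfc
    let lastStep : (ℕ → E) → E → ℝ≥0∞ := fun b e => f (Function.update (trunc c n b) n e)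
    have measurable_lastStep : Measurable (Function.uncurry lastStep) :=
      hf.comp (measurable_update'.comp
        (((measurable_trunc c n).comp measurable_fst).prodMk measurable_snd))
    have lastStep_trunc b e : lastStep (trunc c n b) e = lastStep b e := by
      simp only [lastStep, trunc_trunc]
    have lastStep_apply b : f b = lastStep b (b n) := by
      simp only [lastStep, update_trunc, hfc]
    rw [lintegral_congr lastStep_apply, lintegral_step n lastStep measurable_lastStep
      lastStep_trunc, ih _ (measurable_lintegral_kernel_height hζ _ x n measurable_lastStep)
        fun b => by simp only [lastStep_trunc, height_trunc c x le_rfl],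
      hV.lintegral_doobKernel_mul_indicator hζ x c n measurable_lastStep lastStep_trunc]
    simp only [lastStep_apply]

end IsHarmonic

end DoobTransform

/-! ### The spine conditioned to stay nonnegative -/

noncomputable section PlusLaw

open Set

lemma integral_eq_integral_toReal_smul_of_measure_eq {Ω G : Type*} {m m0 : MeasurableSpace Ω}
    [NormedAddCommGroup G] [NormedSpace ℝ G] (hm : m ≤ m0) {μ ν : Measure Ω} {D : Ω → ℝ≥0∞}
    (hD : Measurable D) (hD_lt_top : ∀ᵐ ω ∂μ, D ω < ∞)
    (measure_eq : ∀ A, MeasurableSet[m] A → ν A = ∫⁻ ω in A, D ω ∂μ) {Z : Ω → G}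
    (hZ : StronglyMeasurable[m] Z) : ∫ ω, Z ω ∂ν = ∫ ω, (D ω).toReal • Z ω ∂μ := by
  have trim_eq : ν.trim hm = (μ.withDensity D).trim hm := by
    refine @Measure.ext _ m _ _ fun A hA => ?_
    rw [trim_measurableSet_eq hm hA, trim_measurableSet_eq hm hA, withDensity_apply _ (hm A hA),
      measure_eq A hA]
  rw [integral_trim hm hZ, trim_eq, ← integral_trim hm hZ,
    integral_withDensity_eq_integral_toReal_smul hD hD_lt_top]

variable {Θ : Measure Offspring} {x ρ : ℝ} {P P' : Measure Path}

lemma measurableSpace_path_eq_generateFrom :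
    (inferInstance : MeasurableSpace Path) =
      MeasurableSpace.generateFrom {A | ∃ n, MeasurableSet[canonicalFiltration n] A} := by
  refine le_antisymm (sup_le ?_ ?_) (MeasurableSpace.generateFrom_le ?_)
  · refine measurable_iff_comap_le.1 (@measurable_pi_lambda _ _ _ (_) _ _ fun u A hA => ?_)
    exact MeasurableSpace.measurableSet_generateFrom
      ⟨u.length, measurable_canonicalFiltration_apply_vertex le_rfl hA⟩
  · refine measurable_iff_comap_le.1 (@measurable_pi_lambda _ _ _ (_) _ _ fun k A hA => ?_)
    exact MeasurableSpace.measurableSet_generateFrom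
      ⟨k, measurable_canonicalFiltration_spine le_rfl hA⟩
  · rintro A ⟨n, hA⟩
    exact canonicalFiltration.le n A hA

lemma IsPlusLaw.unique (hP : IsPlusLaw Θ x P) (hP' : IsPlusLaw Θ x P') : P = P' := by
  have := hP.isProbabilityMeasure
  have := hP'.isProbabilityMeasure
  refine ext_of_generate_finite _ measurableSpace_path_eq_generateFrom ?_ ?_
    (by rw [measure_univ, measure_univ])
  · rintro A ⟨m, hA⟩ B ⟨n, hB⟩ -
    exact ⟨max m n, (canonicalFiltration.mono (le_max_left m n) A hA).inter
      (canonicalFiltration.mono (le_max_right m n) B hB)⟩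
  · rintro A ⟨n, hA⟩
    rw [hP.density n A hA, hP'.density n A hA]

/-- The density of `P⁺_x` with respect to `P*_x` in generation `n`, in terms of `spineHeight`. -/
def plusDensity (Θ : Measure Offspring) (x : ℝ) (n : ℕ) : Path → ℝ≥0∞ :=
  (stayHeight n).indicator fun ω => renewal Θ (spineHeight n ω) / renewal Θ x

/-- The conditional probability, given the first `n` generations, that the spine stays nonnegative
up to time `n + j`. -/
def stayDensity (Θ : Measure Offspring) (n j : ℕ) : Path → ℝ≥0∞ :=
  (stayHeight n).indicator fun ω => survival (stepLaw Θ) j (spineHeight n ω)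

lemma measurable_stayDensity (n j : ℕ) : Measurable (stayDensity Θ n j) :=
  ((measurable_survival j).comp (measurable_of_canonicalFiltration
    (measurable_spineHeight n))).indicator (canonicalFiltration.le n _ (measurableSet_stayHeight n))

variable [IsProbabilityMeasure (spineStep Θ)]

lemma ae_spineHeight_zero (x : ℝ) : ∀ᵐ ω ∂starLaw Θ x, spineHeight 0 ω = x := by
  refine (ae_map_iff (measurable_pathOf x).aemeasurable (measurable_of_canonicalFiltration
    (measurable_spineHeight 0) (measurableSet_singleton x))).2 ?_
  filter_upwards [ae_inputLaw_ne_top] with a ha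
  exact (spineHeight_pathOf x ha 0).trans (height_zero ..)

lemma setLIntegral_stayNonneg_eq (x : ℝ) (n : ℕ) (A : Set Path) :
    ∫⁻ ω in A, (stayNonneg n).indicator
        (fun ω => renewal Θ ((spinePos n ω).untopD 0) / renewal Θ x) ω ∂starLaw Θ x =
      ∫⁻ ω in A, plusDensity Θ x n ω ∂starLaw Θ x := by
  refine lintegral_congr_ae (ae_restrict_of_ae ?_)
  filter_upwards [ae_spinePos_eq x, ae_mem_stayNonneg_iff x] with ω spinePos_eq mem_iff
  exact indicator_eq_indicator (mem_iff n) (by rw [spinePos_eq, WithTop.untopD_coe])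

lemma IsPlusLaw.measure_eq (hP : IsPlusLaw Θ x P) {n : ℕ} {A : Set Path}
    (hA : MeasurableSet[canonicalFiltration n] A) :
    P A = ∫⁻ ω in A, plusDensity Θ x n ω ∂starLaw Θ x := by
  rw [hP.density n A hA, setLIntegral_stayNonneg_eq]

lemma IsPlusLaw.lintegral_plusDensity (hP : IsPlusLaw Θ x P) (n : ℕ) :
    ∫⁻ ω, plusDensity Θ x n ω ∂starLaw Θ x = 1 := by
  have := hP.isProbabilityMeasure
  rw [← setLIntegral_univ, ← hP.measure_eq MeasurableSet.univ, measure_univ]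

lemma IsPlusLaw.ae_of_ae (hP : IsPlusLaw Θ x P) {n : ℕ} {A : Set Path}
    (hA : MeasurableSet[canonicalFiltration n] A) (ae_mem : ∀ᵐ ω ∂starLaw Θ x, ω ∈ A) :
    ∀ᵐ ω ∂P, ω ∈ A := by
  change P Aᶜ = 0
  rw [hP.measure_eq hA.compl]
  exact setLIntegral_measure_zero _ _ ae_mem

lemma stayDensity_lt_top (n j : ℕ) (ω : Path) : stayDensity Θ n j ω < ∞ := by
  unfold stayDensity indicator
  split_ifs
  · exact (survival_ne_top _ _).lt_top
  · exact ENNReal.zero_lt_top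

lemma lintegral_starLaw_survival (x : ℝ) (n j : ℕ) {Z : Path → ℝ≥0∞}
    (hZ : Measurable[canonicalFiltration n] Z) :
    ∫⁻ ω, Z ω * (stayHeight (n + j)).indicator 1 ω ∂starLaw Θ x =
      ∫⁻ ω, Z ω * stayDensity Θ n j ω ∂starLaw Θ x := by
  induction j generalizing n with
  | zero => rfl
  | succ j ih =>
    rw [← Nat.add_assoc, Nat.add_right_comm,
      ih (n + 1) (measurable_canonicalFiltration_of_le n.le_succ hZ)]
    exact lintegral_starLaw_step x n hZ (measurable_survival j)

lemma measure_restrict_stayHeight (x : ℝ) (n j : ℕ) {A : Set Path}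
    (hA : MeasurableSet[canonicalFiltration n] A) :
    (starLaw Θ x).restrict (stayHeight (n + j)) A =
      ∫⁻ ω in A, stayDensity Θ n j ω ∂starLaw Θ x := by
  have measurableSet_A := canonicalFiltration.le n A hA
  have measurableSet_stay := canonicalFiltration.le _ _ (measurableSet_stayHeight (n + j))
  rw [Measure.restrict_apply measurableSet_A,
    ← lintegral_indicator_one (measurableSet_A.inter measurableSet_stay), inter_indicator_one,
    ← lintegral_indicator measurableSet_A]
  simpa only [Pi.mul_apply, indicator, Pi.one_apply, ite_mul, one_mul, zero_mul] using
    lintegral_starLaw_survival (Θ := Θ) x n j (Z := A.indicator 1)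
      (Measurable.indicator measurable_const hA)

lemma setIntegral_stayHeight (x : ℝ) (n j : ℕ) {Z : Path → ℝ}
    (hZ : Measurable[canonicalFiltration n] Z) :
    ∫ ω in stayHeight (n + j), Z ω ∂starLaw Θ x =
      ∫ ω, (stayDensity Θ n j ω).toReal * Z ω ∂starLaw Θ x :=
  integral_eq_integral_toReal_smul_of_measure_eq (canonicalFiltration.le n)
    (measurable_stayDensity n j) (ae_of_all _ (stayDensity_lt_top n j))
    (fun _ hA => measure_restrict_stayHeight x n j hA) hZ.stronglyMeasurable

variable [IsProbabilityMeasure Θ]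

lemma measurable_renewal : Measurable (renewal Θ) := by
  rw [funext renewal_eq]
  exact measurable_renewalFn

lemma isHarmonic_renewal (hS : SpitzerLaw (stepLaw Θ) ρ) : IsHarmonic (stepLaw Θ) (renewal Θ) := by
  rw [funext renewal_eq]
  exact
    { measurable := measurable_renewalFn
      ne_zero := fun _ hs => (zero_lt_one.trans_le (one_le_renewalFn hs)).ne'
      ne_top := fun _ hs => renewalFn_ne_top hS.measure_Ioi_ne_zero hs
      walkOp_eq := fun _ hs => hS.walkOp_renewalFn hs }

lemma measurable_plusDensity (x : ℝ) (n : ℕ) :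
    Measurable[canonicalFiltration n] (plusDensity Θ x n) :=
  ((measurable_renewal.comp (measurable_spineHeight n)).div_const _).indicator
    (measurableSet_stayHeight n)

lemma setLIntegral_plusDensity (x : ℝ) (n : ℕ) {A : Set Path} (hA : MeasurableSet A) :
    ∫⁻ ω in A, plusDensity Θ x n ω ∂starLaw Θ x =
      (∫⁻ ω, A.indicator 1 ω * (stayHeight n).indicator (fun ω => renewal Θ (spineHeight n ω)) ω
        ∂starLaw Θ x) / renewal Θ x := by
  have measurable_weight_renewal : Measurable fun ω => A.indicator 1 ω *
      (stayHeight n).indicator (fun ω => renewal Θ (spineHeight n ω)) ω :=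
    (measurable_one.indicator hA).mul ((measurable_renewal.comp
      (measurable_of_canonicalFiltration (measurable_spineHeight n))).indicator
        (canonicalFiltration.le n _ (measurableSet_stayHeight n)))
  rw [div_eq_mul_inv, ← lintegral_mul_const _ measurable_weight_renewal, ← lintegral_indicator hA]
  refine lintegral_congr fun ω => ?_
  simp only [plusDensity, indicator, Pi.one_apply, ite_mul, one_mul, zero_mul, div_eq_mul_inv]

lemma exists_isPlusLaw (hV : IsHarmonic (stepLaw Θ) (renewal Θ)) (hx : 0 ≤ x) :
    ∃ P, IsPlusLaw Θ x P := by
  obtain ⟨Q, _, lintegral_Q⟩ :=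
    IsHarmonic.exists_measure_lintegral (ν := spineStep Θ) hV measurable_stepHeight hx 0
  refine ⟨((Measure.infinitePi fun _ : Vertex => Θ).prod Q).map (pathOf x),
    Measure.isProbabilityMeasure_map (measurable_pathOf x).aemeasurable, fun n A hA => ?_⟩
  have measurableSet_A := canonicalFiltration.le n A hA
  have measurable_one_A : Measurable[canonicalFiltration n] (A.indicator (1 : Path → ℝ≥0∞)) :=
    Measurable.indicator measurable_const hA
  have measurable_one_A' := measurable_of_canonicalFiltration measurable_one_A
  rw [setLIntegral_stayNonneg_eq, setLIntegral_plusDensity x n measurableSet_A,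
    ENNReal.eq_div_iff (hV.ne_zero x hx) (hV.ne_top x hx), mul_comm,
    lintegral_starLaw_mul_indicator_stayHeight x n measurable_one_A' hV.measurable,
    ← lintegral_indicator_one measurableSet_A,
    lintegral_map measurable_one_A' (measurable_pathOf x),
    lintegral_prod (fun a => A.indicator 1 (pathOf x a))
      (measurable_one_A'.comp (measurable_pathOf x)).aemeasurable,
    ← lintegral_mul_const' _ _ (hV.ne_top x hx)]
  refine lintegral_congr fun a => lintegral_Q n (fun b => A.indicator 1 (pathOf x (a, b))) ?_ ?_
  · exact measurable_one_A'.comp ((measurable_pathOf x).comp measurable_prodMk_left)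
  · exact fun b => apply_pathOf_truncInput x measurable_one_A (a, b)

lemma IsPlusLaw.integrable_plusDensity (hP : IsPlusLaw Θ x P) (n : ℕ) :
    Integrable (fun ω => (plusDensity Θ x n ω).toReal) (starLaw Θ x) :=
  integrable_toReal_of_lintegral_ne_top
    (measurable_of_canonicalFiltration (measurable_plusDensity x n)).aemeasurable
    (by rw [hP.lintegral_plusDensity]; exact ENNReal.one_ne_top)

lemma IsPlusLaw.integral_eq (hP : IsPlusLaw Θ x P) {n : ℕ} {Z : Path → ℝ}
    (hZ : Measurable[canonicalFiltration n] Z) :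
    ∫ ω, Z ω ∂P = ∫ ω, (plusDensity Θ x n ω).toReal * Z ω ∂starLaw Θ x := by
  have measurable_density := measurable_of_canonicalFiltration (measurable_plusDensity (Θ := Θ) x n)
  exact integral_eq_integral_toReal_smul_of_measure_eq (canonicalFiltration.le n) measurable_density
    (ae_lt_top measurable_density (by rw [hP.lintegral_plusDensity]; exact ENNReal.one_ne_top))
    (fun _ hA => hP.measure_eq hA) hZ.stronglyMeasurable

lemma starLaw_stayHeight (hx : 0 ≤ x) (n : ℕ) :
    starLaw Θ x (stayHeight n) = survival (stepLaw Θ) n x := by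
  have stayDensity_zero : ∀ᵐ ω ∂starLaw Θ x, stayDensity Θ 0 n ω = survival (stepLaw Θ) n x := by
    filter_upwards [ae_spineHeight_zero x] with ω spineHeight_eq
    have mem_stayHeight : ω ∈ stayHeight 0 := fun k hk => by
      rwa [Nat.le_zero.1 hk, spineHeight_eq]
    rw [stayDensity, indicator_of_mem mem_stayHeight, spineHeight_eq]
  calc starLaw Θ x (stayHeight n)
      = (starLaw Θ x).restrict (stayHeight (0 + n)) univ := by
        rw [zero_add, Measure.restrict_apply_univ]
    _ = ∫⁻ ω, stayDensity Θ 0 n ω ∂starLaw Θ x := by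
        rw [measure_restrict_stayHeight x 0 n MeasurableSet.univ, setLIntegral_univ]
    _ = survival (stepLaw Θ) n x := by
        rw [lintegral_congr_ae stayDensity_zero, lintegral_const, measure_univ, mul_one]

end PlusLaw

/-! ### Limits of conditional expectations -/

section BoundedConvergence

variable {Ω : Type*} [MeasurableSpace Ω] {μ : Measure Ω} {Y : ℕ → Ω → ℝ} {Y' : Ω → ℝ} {C : ℝ}

lemma ae_abs_le_of_tendstoInMeasure (hC : ∀ n, ∀ᵐ ω ∂μ, |Y n ω| ≤ C)
    (hlim : TendstoInMeasure μ Y atTop Y') : ∀ᵐ ω ∂μ, |Y' ω| ≤ C := by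
  obtain ⟨ns, -, tendsto_subseq⟩ := hlim.exists_seq_tendsto_ae
  filter_upwards [ae_all_iff.2 hC, tendsto_subseq] with ω abs_le tendsto_apply
  exact le_of_tendsto tendsto_apply.abs (Eventually.of_forall fun i => abs_le (ns i))

lemma tendsto_integral_abs_sub_of_tendstoInMeasure [IsFiniteMeasure μ] (hY : ∀ n, Measurable (Y n))
    (hY' : Measurable Y') (hC : ∀ n, ∀ᵐ ω ∂μ, |Y n ω| ≤ C)
    (hlim : TendstoInMeasure μ Y atTop Y') :
    Tendsto (fun n => ∫ ω, |Y n ω - Y' ω| ∂μ) atTop (𝓝 0) := by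
  refine tendsto_of_subseq_tendsto fun ns hns => ?_
  obtain ⟨ms, -, tendsto_subseq⟩ := (hlim.comp hns).exists_seq_tendsto_ae
  refine ⟨ms, ?_⟩
  rw [← integral_zero Ω ℝ (μ := μ)]
  refine tendsto_integral_of_dominated_convergence (fun _ => C + C)
    (fun n => ((hY _).sub hY').norm.aestronglyMeasurable) (integrable_const _) (fun n => ?_) ?_
  · filter_upwards [hC (ns (ms n)), ae_abs_le_of_tendstoInMeasure hC hlim] with ω abs_le abs_le'
    rw [Real.norm_eq_abs, abs_abs]
    exact (abs_sub _ _).trans (add_le_add abs_le abs_le')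
  · filter_upwards [tendsto_subseq] with ω tendsto_apply
    simpa using (tendsto_apply.sub_const (Y' ω)).abs

lemma integral_abs_sub_le {f g h : Ω → ℝ} (hf : Integrable f μ) (hg : Integrable g μ)
    (hh : Integrable h μ) :
    ∫ ω, |f ω - g ω| ∂μ ≤ ∫ ω, |f ω - h ω| ∂μ + ∫ ω, |g ω - h ω| ∂μ := by
  have integrable_fh : Integrable (fun ω => |f ω - h ω|) μ := (hf.sub hh).abs
  have integrable_gh : Integrable (fun ω => |g ω - h ω|) μ := (hg.sub hh).abs
  rw [← integral_add integrable_fh integrable_gh]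
  refine integral_mono (hf.sub hg).abs (integrable_fh.add integrable_gh) fun ω => ?_
  exact (abs_sub_le _ (h ω) _).trans_eq (congrArg _ (abs_sub_comm _ _))

end BoundedConvergence

lemma tendsto_of_dist_le_add {α : Type*} [PseudoMetricSpace α] {a l : ℕ → α} {b : ℕ → ℕ → α}
    {L : α} {c : ℕ → ℝ} (hb : ∀ k, Tendsto (b k) atTop (𝓝 (l k))) (hl : Tendsto l atTop (𝓝 L))
    (hc : Tendsto c atTop (𝓝 0)) (dist_le : ∀ k n, k ≤ n → dist (a n) (b k n) ≤ c n + c k) :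
    Tendsto a atTop (𝓝 L) := by
  refine Metric.tendsto_nhds.2 fun ε hε => ?_
  have ε_div_pos : 0 < ε / 4 := by positivity
  obtain ⟨k, c_lt, dist_l_lt⟩ := ((hc.eventually_lt_const ε_div_pos).and
    (Metric.tendsto_nhds.1 hl _ ε_div_pos)).exists
  filter_upwards [hc.eventually_lt_const ε_div_pos, Metric.tendsto_nhds.1 (hb k) _ ε_div_pos,
    eventually_ge_atTop k] with n c_lt' dist_b_lt hkn
  linarith [dist_triangle4 (a n) (b k n) (l k) L, dist_le k n hkn]

lemma abs_div_sub_div_le {a b p r C : ℝ} (hr : 0 < r) (hrp : r ≤ p) (hab : |a - b| ≤ C * (p - r))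
    (hb : |b| ≤ C * r) : |a / p - b / r| ≤ 2 * C * (1 - r / p) := by
  have hp : 0 < p := hr.trans_le hrp
  have ratio_nonneg : 0 ≤ (p - r) / (r * p) := div_nonneg (sub_nonneg.2 hrp) (by positivity)
  calc |a / p - b / r| = |(a - b) / p - b * ((p - r) / (r * p))| := by
        congr 1
        field_simp
        ring
    _ ≤ |(a - b) / p| + |b * ((p - r) / (r * p))| := abs_sub _ _
    _ = |a - b| / p + |b| * ((p - r) / (r * p)) := by
        rw [abs_div, abs_mul, abs_of_pos hp, abs_of_nonneg ratio_nonneg]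
    _ ≤ C * (p - r) / p + C * r * ((p - r) / (r * p)) := by gcongr
    _ = 2 * C * (1 - r / p) := by field_simp; ring

noncomputable section Conditioning

open Set

lemma stayHeight_antitone : Antitone stayHeight :=
  fun _ _ hmn _ hω k hk => hω k (hk.trans hmn)

/-- The expectation of `Z` under `P*_x` conditioned on the spine staying nonnegative up to time
`m`, when `0 ≤ x`. -/
def stayMean (Θ : Measure Offspring) (x : ℝ) (m : ℕ) (Z : Path → ℝ) : ℝ :=
  (∫ ω in stayHeight m, Z ω ∂starLaw Θ x) / (survival (stepLaw Θ) m x).toReal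

variable {Θ : Measure Offspring} {x ρ C : ℝ} {P : Measure Path} {Z Z' : Path → ℝ}

lemma stayMean_sub (m : ℕ) (hZ : Integrable Z (starLaw Θ x)) (hZ' : Integrable Z' (starLaw Θ x)) :
    stayMean Θ x m (fun ω => Z ω - Z' ω) = stayMean Θ x m Z - stayMean Θ x m Z' := by
  rw [stayMean, stayMean, stayMean, ← sub_div, integral_sub hZ.integrableOn hZ'.integrableOn]

variable [IsProbabilityMeasure (spineStep Θ)]

lemma stayMean_eq (x : ℝ) (n j : ℕ) (hZ : Measurable[canonicalFiltration n] Z) :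
    stayMean Θ x (n + j) Z = ∫ ω, (stayDensity Θ n j ω).toReal /
      (survival (stepLaw Θ) (n + j) x).toReal * Z ω ∂starLaw Θ x := by
  rw [stayMean, setIntegral_stayHeight x n j hZ, ← integral_div]
  exact integral_congr_ae (ae_of_all _ fun ω => by ring)

lemma IsPlusLaw.ae_abs_le (hP : IsPlusLaw Θ x P) {n : ℕ} (hZ : Measurable[canonicalFiltration n] Z)
    (hC : ∀ᵐ ω ∂starLaw Θ x, |Z ω| ≤ C) : ∀ᵐ ω ∂P, |Z ω| ≤ C :=
  hP.ae_of_ae (A := {ω | |Z ω| ≤ C}) (continuous_abs.measurable.comp hZ measurableSet_Iic) hC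

variable [IsProbabilityMeasure Θ]

lemma integral_cond_stayNonneg (hx : 0 ≤ x) (n : ℕ) (Z : Path → ℝ) :
    ∫ ω, Z ω ∂cond (starLaw Θ x) (stayNonneg n) = stayMean Θ x n Z := by
  have stayNonneg_ae_eq : (stayNonneg n : Set Path) =ᵐ[starLaw Θ x] stayHeight n :=
    (ae_mem_stayNonneg_iff x).mono fun ω mem_iff => propext (mem_iff n)
  rw [ProbabilityTheory.cond, measure_congr stayNonneg_ae_eq,
    Measure.restrict_congr_set stayNonneg_ae_eq, integral_smul_measure, starLaw_stayHeight hx,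
    ENNReal.toReal_inv, smul_eq_mul, inv_mul_eq_div, stayMean]

lemma exists_stayDensity_le (hS : SpitzerLaw (stepLaw Θ) ρ) (hx : 0 ≤ x) (q : ℕ) :
    ∃ K : ℝ, 0 ≤ K ∧ ∀ n j : ℕ, n ≤ q * (j + 1) → ∀ ω,
      (stayDensity Θ n j ω).toReal / (survival (stepLaw Θ) (n + j) x).toReal ≤
        K * (plusDensity Θ x n ω).toReal := by
  obtain ⟨K, ratio_le⟩ := hS.exists_survival_div_le q
  have renewal_pos : 0 < (renewal Θ x).toReal := by
    rw [renewal_eq]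
    exact zero_lt_one.trans_le (one_le_toReal_renewalFn hS.measure_Ioi_ne_zero hx)
  refine ⟨|K| * (renewal Θ x).toReal, by positivity, fun n j hnj ω => ?_⟩
  by_cases hω : ω ∈ stayHeight n
  · rw [stayDensity, plusDensity, indicator_of_mem hω, indicator_of_mem hω, ENNReal.toReal_div,
      mul_assoc, mul_div_cancel₀ _ renewal_pos.ne', renewal_eq]
    refine (ratio_le n j hnj x _ hx (hω n le_rfl)).trans ?_
    gcongr
    exact le_abs_self K
  · simp [stayDensity, plusDensity, hω]

lemma tendsto_stayDensity (hS : SpitzerLaw (stepLaw Θ) ρ) (hx : 0 ≤ x) (n : ℕ) (ω : Path) :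
    Tendsto (fun j => (stayDensity Θ n j ω).toReal / (survival (stepLaw Θ) (n + j) x).toReal) atTop
      (𝓝 (plusDensity Θ x n ω).toReal) := by
  by_cases hω : ω ∈ stayHeight n
  · simp only [stayDensity, plusDensity, indicator_of_mem hω, ENNReal.toReal_div, renewal_eq]
    exact hS.tendsto_survival_ratio n hx (hω n le_rfl)
  · simp [stayDensity, plusDensity, hω]

lemma abs_stayMean_sub_le (hF : stepLaw Θ (Ioi 0) ≠ 0) (hx : 0 ≤ x) {n m : ℕ} (hnm : n ≤ m)
    (hZ : Integrable Z (starLaw Θ x)) (hC : ∀ᵐ ω ∂starLaw Θ x, |Z ω| ≤ C) :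
    |stayMean Θ x n Z - stayMean Θ x m Z| ≤
      2 * C * (1 - (survival (stepLaw Θ) m x).toReal / (survival (stepLaw Θ) n x).toReal) := by
  have measurableSet_stay : MeasurableSet (stayHeight m) :=
    canonicalFiltration.le m _ (measurableSet_stayHeight m)
  have real_stayHeight k :
      (starLaw Θ x).real (stayHeight k) = (survival (stepLaw Θ) k x).toReal := by
    rw [Measure.real, starLaw_stayHeight hx]
  have abs_setIntegral_le (A : Set Path) :
      |∫ ω in A, Z ω ∂starLaw Θ x| ≤ C * (starLaw Θ x).real A :=
    norm_setIntegral_le_of_norm_le_const_ae' (f := Z) (C := C) (measure_lt_top _ A)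
      (hC.mono fun _ hω _ => hω)
  refine abs_div_sub_div_le (toReal_survival_pos hF m hx) (toReal_survival_antitone x hnm) ?_ ?_
  · rw [← setIntegral_sdiff measurableSet_stay hZ.integrableOn (stayHeight_antitone hnm),
      ← real_stayHeight, ← real_stayHeight,
      ← measureReal_sdiff (stayHeight_antitone hnm) measurableSet_stay]
    exact abs_setIntegral_le _
  · rw [← real_stayHeight]
    exact abs_setIntegral_le _

lemma exists_eventually_abs_stayMean_sub_le (hS : SpitzerLaw (stepLaw Θ) ρ) (hx : 0 ≤ x)
    (hC : 0 ≤ C) {ε : ℝ} (hε : 0 < ε) :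
    ∃ q : ℕ, 0 < q ∧ ∀ᶠ n in atTop, ∀ Z : Path → ℝ, Integrable Z (starLaw Θ x) →
      (∀ᵐ ω ∂starLaw Θ x, |Z ω| ≤ C) →
        |stayMean Θ x n Z - stayMean Θ x (n + n / q) Z| ≤ ε := by
  let δ := ε / (2 * C + 1)
  have δ_pos : 0 < δ := by positivity
  obtain ⟨q, hq, eventually_le⟩ := hS.exists_eventually_survival_le hx (lt_add_of_pos_right 1 δ_pos)
  refine ⟨q, hq, eventually_le.mono fun n survival_le Z hZ abs_le => ?_⟩
  have survival_pos := toReal_survival_pos hS.measure_Ioi_ne_zero n hx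
  have survival_antitone := toReal_survival_antitone (F := stepLaw Θ) x (Nat.le_add_right n (n / q))
  refine (abs_stayMean_sub_le hS.measure_Ioi_ne_zero hx (Nat.le_add_right n (n / q)) hZ
    abs_le).trans ?_
  calc 2 * C * (1 - (survival (stepLaw Θ) (n + n / q) x).toReal /
          (survival (stepLaw Θ) n x).toReal)
      ≤ 2 * C * δ := by
        gcongr
        rw [sub_le_comm, le_div_iff₀ survival_pos]
        nlinarith
    _ ≤ (2 * C + 1) * δ := by gcongr; exact le_add_of_nonneg_right zero_le_one
    _ = ε := mul_div_cancel₀ _ (by positivity)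

namespace IsPlusLaw

lemma integrable_plusDensity_mul (hP : IsPlusLaw Θ x P) (n : ℕ)
    (hZ : AEStronglyMeasurable Z (starLaw Θ x)) (hC : ∀ᵐ ω ∂starLaw Θ x, |Z ω| ≤ C) :
    Integrable (fun ω => (plusDensity Θ x n ω).toReal * |Z ω|) (starLaw Θ x) :=
  (hP.integrable_plusDensity n).mul_bdd hZ.norm (hC.mono fun _ hω => (abs_abs _).trans_le hω)

lemma tendsto_stayMean (hS : SpitzerLaw (stepLaw Θ) ρ) (hx : 0 ≤ x) (hP : IsPlusLaw Θ x P) {n : ℕ}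
    (hZ : Measurable[canonicalFiltration n] Z) (hC : ∀ᵐ ω ∂starLaw Θ x, |Z ω| ≤ C) :
    Tendsto (fun m => stayMean Θ x m Z) atTop (𝓝 (∫ ω, Z ω ∂P)) := by
  obtain ⟨K, -, density_le⟩ := exists_stayDensity_le hS hx n
  have measurable_Z := measurable_of_canonicalFiltration hZ
  rw [← tendsto_add_atTop_iff_nat n, hP.integral_eq hZ]
  simp only [add_comm _ n, stayMean_eq x n _ hZ]
  refine tendsto_integral_of_dominated_convergence
    (fun ω => K * ((plusDensity Θ x n ω).toReal * |Z ω|))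
    (fun j => (((measurable_stayDensity n j).ennreal_toReal.div_const _).mul
      measurable_Z).aestronglyMeasurable)
    ((hP.integrable_plusDensity_mul n measurable_Z.aestronglyMeasurable hC).const_mul K)
    (fun j => ae_of_all _ fun ω => ?_)
    (ae_of_all _ fun ω => (tendsto_stayDensity hS hx n ω).mul_const _)
  rw [norm_mul, Real.norm_of_nonneg (by positivity), ← mul_assoc, Real.norm_eq_abs]
  have n_le : n ≤ n * (j + 1) := Nat.le_mul_of_pos_right n j.succ_pos
  exact mul_le_mul_of_nonneg_right (density_le n j n_le ω) (abs_nonneg _)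

lemma exists_abs_stayMean_le (hS : SpitzerLaw (stepLaw Θ) ρ) (hx : 0 ≤ x) (hP : IsPlusLaw Θ x P)
    (q : ℕ) :
    ∃ K : ℝ, 0 ≤ K ∧ ∀ n j : ℕ, n ≤ q * (j + 1) → ∀ Z : Path → ℝ,
      Measurable[canonicalFiltration n] Z → (∃ C : ℝ, ∀ᵐ ω ∂starLaw Θ x, |Z ω| ≤ C) →
        |stayMean Θ x (n + j) Z| ≤ K * ∫ ω, |Z ω| ∂P := by
  obtain ⟨K, hK, density_le⟩ := exists_stayDensity_le hS hx q
  refine ⟨K, hK, fun n j hnj Z hZ ⟨C, hC⟩ => ?_⟩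
  have measurable_Z := measurable_of_canonicalFiltration hZ
  have measurable_abs : Measurable[canonicalFiltration n] fun ω => |Z ω| :=
    continuous_abs.measurable.comp hZ
  rw [stayMean_eq x n j hZ, hP.integral_eq measurable_abs, ← integral_const_mul, ← Real.norm_eq_abs]
  refine norm_integral_le_of_norm_le
    ((hP.integrable_plusDensity_mul n measurable_Z.aestronglyMeasurable hC).const_mul K)
    (ae_of_all _ fun ω => ?_)
  rw [norm_mul, Real.norm_of_nonneg (by positivity), ← mul_assoc, Real.norm_eq_abs]
  exact mul_le_mul_of_nonneg_right (density_le n j hnj ω) (abs_nonneg _)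

variable {Y : ℕ → Path → ℝ} {Y' : Path → ℝ}

/-- If the conditioning exceeds the generation by a fixed proportion, the conditional densities are
dominated by the density of `P⁺_x`, so that `Y n` may be replaced with a fixed `Y k`. -/
lemma tendsto_stayMean_add_div (hS : SpitzerLaw (stepLaw Θ) ρ) (hx : 0 ≤ x) (hP : IsPlusLaw Θ x P)
    (hY : Adapted canonicalFiltration Y) (hC : ∀ n, ∀ᵐ ω ∂starLaw Θ x, |Y n ω| ≤ C)
    (hY' : Measurable Y') (hlim : TendstoInMeasure P Y atTop Y') {q : ℕ} (hq : 0 < q) :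
    Tendsto (fun n => stayMean Θ x (n + n / q) (Y n)) atTop (𝓝 (∫ ω, Y' ω ∂P)) := by
  have := hP.isProbabilityMeasure
  have measurable_Y n := measurable_of_canonicalFiltration (hY n)
  have integrable_star n : Integrable (Y n) (starLaw Θ x) :=
    .of_bound (measurable_Y n).aestronglyMeasurable C (hC n)
  have ae_le n := hP.ae_abs_le (hY n) (hC n)
  have integrable_Y n : Integrable (Y n) P :=
    .of_bound (measurable_Y n).aestronglyMeasurable C (ae_le n)
  have integrable_Y' : Integrable Y' P :=
    .of_bound hY'.aestronglyMeasurable C (ae_abs_le_of_tendstoInMeasure ae_le hlim)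
  obtain ⟨K, hK, stayMean_le⟩ := hP.exists_abs_stayMean_le hS hx q
  let d : ℕ → ℝ := fun n => ∫ ω, |Y n ω - Y' ω| ∂P
  have abs_stayMean_sub_le {k n : ℕ} (hkn : k ≤ n) :
      |stayMean Θ x (n + n / q) (Y n) - stayMean Θ x (n + n / q) (Y k)| ≤ K * (d n + d k) := by
    rw [← stayMean_sub _ (integrable_star n) (integrable_star k)]
    refine (stayMean_le n (n / q) (Nat.lt_mul_div_succ n hq).le _
      ((hY n).sub (measurable_canonicalFiltration_of_le hkn (hY k))) ⟨C + C, ?_⟩).trans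
        (mul_le_mul_of_nonneg_left
          (integral_abs_sub_le (integrable_Y n) (integrable_Y k) integrable_Y') hK)
    filter_upwards [hC n, hC k] with ω abs_le_n abs_le_k
    exact (abs_sub _ _).trans (add_le_add abs_le_n abs_le_k)
  have abs_integral_sub_le k : |∫ ω, Y k ω ∂P - ∫ ω, Y' ω ∂P| ≤ d k := by
    rw [← integral_sub (integrable_Y k) integrable_Y']
    exact abs_integral_le_integral_abs
  have tendsto_d : Tendsto d atTop (𝓝 0) :=
    tendsto_integral_abs_sub_of_tendstoInMeasure measurable_Y hY' ae_le hlim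
  refine tendsto_of_dist_le_add (l := fun k => ∫ ω, Y k ω ∂P) (c := fun n => K * d n)
    (fun k => (tendsto_stayMean hS hx hP (hY k) (hC k)).comp
      (tendsto_atTop_mono (fun n => Nat.le_add_right n (n / q)) tendsto_id))
    (tendsto_iff_dist_tendsto_zero.2
      (squeeze_zero (fun _ => dist_nonneg) abs_integral_sub_le tendsto_d))
    (by simpa using tendsto_d.const_mul K) fun k n hkn => ?_
  exact (abs_stayMean_sub_le hkn).trans_eq (mul_add _ _ _)

theorem tendsto_stayMean_of_tendstoInMeasure (hS : SpitzerLaw (stepLaw Θ) ρ) (hx : 0 ≤ x)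
    (hP : IsPlusLaw Θ x P) (hY : Adapted canonicalFiltration Y)
    (hC : ∀ n, ∀ᵐ ω ∂starLaw Θ x, |Y n ω| ≤ C) (hY' : Measurable Y')
    (hlim : TendstoInMeasure P Y atTop Y') :
    Tendsto (fun n => stayMean Θ x n (Y n)) atTop (𝓝 (∫ ω, Y' ω ∂P)) := by
  have integrable_Y n : Integrable (Y n) (starLaw Θ x) :=
    .of_bound (measurable_of_canonicalFiltration (hY n)).aestronglyMeasurable C (hC n)
  have C_nonneg : 0 ≤ C := by
    obtain ⟨ω, hω⟩ := (hC 0).exists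
    exact (abs_nonneg _).trans hω
  refine Metric.tendsto_nhds.2 fun ε hε => ?_
  obtain ⟨q, hq, eventually_sub_le⟩ :=
    exists_eventually_abs_stayMean_sub_le hS hx C_nonneg (half_pos hε)
  filter_upwards [eventually_sub_le,
    Metric.tendsto_nhds.1 (hP.tendsto_stayMean_add_div hS hx hY hC hY' hlim hq) _ (half_pos hε)]
    with n sub_le dist_lt
  calc dist (stayMean Θ x n (Y n)) (∫ ω, Y' ω ∂P)
      ≤ dist (stayMean Θ x n (Y n)) (stayMean Θ x (n + n / q) (Y n)) +
          dist (stayMean Θ x (n + n / q) (Y n)) (∫ ω, Y' ω ∂P) := dist_triangle _ _ _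
    _ < ε / 2 + ε / 2 := add_lt_add_of_le_of_lt (sub_le (Y n) (integrable_Y n) (hC n)) dist_lt
    _ = ε := add_halves ε

end IsPlusLaw

end Conditioning

end SpinalBRW

theorem mainTheorem5_general
    (Θ : Measure SpinalBRW.Offspring) [IsProbabilityMeasure Θ]
    [IsProbabilityMeasure (SpinalBRW.spineStep Θ)] {ρ : ℝ}
    (hS : SpinalBRW.SpitzerLaw (SpinalBRW.stepLaw Θ) ρ) (x : ℝ) (hx : 0 ≤ x) :
    (∃! P : Measure SpinalBRW.Path, SpinalBRW.IsPlusLaw Θ x P) ∧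
    ∀ Pplus : Measure SpinalBRW.Path, SpinalBRW.IsPlusLaw Θ x Pplus →
      ∀ (Y : ℕ → SpinalBRW.Path → ℝ) (Yinf : SpinalBRW.Path → ℝ),
        Adapted SpinalBRW.canonicalFiltration Y →
        (∃ C : ℝ, ∀ n, ∀ᵐ ω ∂(SpinalBRW.starLaw Θ x), |Y n ω| ≤ C) →
        Measurable Yinf →
        TendstoInMeasure Pplus Y atTop Yinf →
        Tendsto
          (fun n => ∫ ω, Y n ω ∂(cond (SpinalBRW.starLaw Θ x) (SpinalBRW.stayNonneg n)))
          atTop (𝓝 (∫ ω, Yinf ω ∂Pplus)) := by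
  obtain ⟨P, hP⟩ := SpinalBRW.exists_isPlusLaw (SpinalBRW.isHarmonic_renewal hS) hx
  refine ⟨⟨P, hP, fun P' hP' => hP'.unique hP⟩, ?_⟩
  rintro P' hP' Y Yinf hY ⟨C, hC⟩ hYinf hlim
  simp only [SpinalBRW.integral_cond_stayNonneg hx]
  exact hP'.tendsto_stayMean_of_tendstoInMeasure hS hx hY hC hYinf hlim

theorem mainTheorem5
    (Θ : Measure SpinalBRW.Offspring) [IsProbabilityMeasure Θ]
    (hΘ : SpinalBRW.BoundaryCase Θ) (x : ℝ) (hx : 0 ≤ x) :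
    (∃! P : Measure SpinalBRW.Path, SpinalBRW.IsPlusLaw Θ x P) ∧
    ∀ Pplus : Measure SpinalBRW.Path, SpinalBRW.IsPlusLaw Θ x Pplus →
      ∀ (Y : ℕ → SpinalBRW.Path → ℝ) (Yinf : SpinalBRW.Path → ℝ),
        Adapted SpinalBRW.canonicalFiltration Y →
        (∃ C : ℝ, ∀ n, ∀ᵐ ω ∂(SpinalBRW.starLaw Θ x), |Y n ω| ≤ C) →
        Measurable Yinf →
        TendstoInMeasure Pplus Y atTop Yinf →
        Tendsto
          (fun n => ∫ ω, Y n ω ∂(cond (SpinalBRW.starLaw Θ x) (SpinalBRW.stayNonneg n)))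
          atTop (𝓝 (∫ ω, Yinf ω ∂Pplus)) := by
  have := SpinalBRW.isProbabilityMeasure_spineStep Θ hΘ
  exact mainTheorem5_general Θ hΘ.centeredLaw.spitzerLaw x hx
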